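/- Throughout, $\theta<\kappa$ are infinite regular cardinals (so $\kappa$ is uncountable), and cardinals are identified with initial ordinals. Notation. For a set $a$ of ordinals, $\mathrm{ssup}(a)=\sup\{\alpha+1\mid\alpha\in a\}$, $\mathrm{acc}^+(a)=\{\alpha<\mathrm{ssup}(a)\mid \sup(a\cap\alpha)=\alpha>0\}$ and $\mathrm{acc}(a)=a\cap\mathrm{acc}^+(a)$. $\mathrm{Reg}(\kappa)$ is the set of infinite regular cardinals below $\kappa$. For sets of ordinals $a,b$, write $a<b$ if $\alpha<\beta$ for all $\alpha\in a$, $\beta\in b$. Colorings. Let $c:[\kappa]^2\to\theta$, and write $c(\alpha,\beta)$ for $c(\{\alpha,\beta\})$ when $\alpha<\beta$. The coloring $c$ is *subadditive* if $c(\alpha,\gamma)\le\max\{c(\alpha,\beta),c(\beta,\gamma)\}$ and $c(\alpha,\beta)\le\max\{c(\alpha,\gamma),c(\beta,\gamma)\}$ for all $\alpha<\beta<\gamma<\kappa$. It is *closed* if, for all $\beta<\kappa$ and $i\le\theta$, the set $D=\{\alpha<\beta\mid c(\alpha,\beta)\le i\}$ satisfies $\mathrm{acc}^+(D)\subseteq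 D$. It *witnesses* $\mathrm U(\kappa,\mu,\theta,\chi)$ if for every cardinal $\sigma<\chi$, every pairwise disjoint family $\mathcal A\subseteq[\kappa]^\sigma$ of size $\kappa$ and every $i<\theta$, there is $\mathcal B\subseteq\mathcal A$ of size $\mu$ such that $c(\alpha,\beta)>i$ whenever $a,b\in\mathcal B$ are distinct, $a<b$, $\alpha\in a$ and $\beta\in b$. Weak indexed square. A *$\boxminus^{\mathrm{ind}}(\kappa,\theta)$-sequence* is a matrix $\langle C_{\alpha,i}\mid\alpha\in\Gamma,\ i(\alpha)\le i<\theta\rangle$ such that (i) $\{\alpha\in\mathrm{acc}(\kappa)\mid\mathrm{cf}(\alpha)\ne\theta\}\subseteq\Gamma\subseteq\mathrm{acc}(\kappa)$; (ii) for all $\alpha\in\Gamma$, $i(\alpha)<\theta$, and $\langle C_{\alpha,i}\mid i(\alpha)\le i<\theta\rangle$ is a $\subseteq$-increasing sequence of clubs in $\alpha$ with $\Gamma\cap\alpha=\bigcup_{i(\alpha)\le i<\theta}\mathrm{acc}(C_{\alpha,i})$; (iii) for all $\alpha\in\Gamma$, $i(\alpha)\le i<\theta$ and $\bar\alpha\in\mathrm{acc}(C_{\alpha,i})$,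 we have $i(\bar\alpha)\le i$ and $C_{\bar\alpha,i}=C_{\alpha,i}\cap\bar\alpha$; (iv) for every club $D$ in $\kappa$ there is $\alpha\in\mathrm{acc}(D)\cap\Gamma$ such that $D\cap\alpha\ne C_{\alpha,i}$ for all $i\in[i(\alpha),\theta)$. The principle $\boxminus^{\mathrm{ind}}(\kappa,\theta)$ asserts that such a sequence exists. Theorem. Let $\theta<\kappa$ be infinite regular cardinals. The following are equivalent: (1) $\boxminus^{\mathrm{ind}}(\kappa,\theta)$ holds; (2) there is a closed, subadditive witness to $\mathrm U(\kappa,2,\theta,2)$; (3) there is a closed, subadditive witness to $\mathrm U(\kappa,\kappa,\theta,\sup(\mathrm{Reg}(\kappa)))$; (4) for every stationary $S\subseteq\kappa$ there is a $\boxminus^{\mathrm{ind}}(\kappa,\theta)$-sequence $\langle C_{\alpha,i}\mid\alpha\in\Gamma,\ i(\alpha)\le i<\theta\rangle$ such that either $S\cap\Gamma$ is nonstationary in $\kappa$ or, for every $i<\theta$, the set $\{\alpha\in S\cap\Gamma\mid i(\alpha)>i\}$ is stationary in $\kappa$. -/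

import Mathlib

open Cardinal Ordinal Set

universe u

/-- `ssup a = sup {α + 1 | α ∈ a}`, the strict supremum of a (bounded) set of ordinals. -/
noncomputable def strictSup (a : Set Ordinal.{u}) : Ordinal.{u} :=
  sSup ((fun α => α + 1) '' a)

/-- `acc⁺(a) = {α < ssup(a) | sup(a ∩ α) = α > 0}`. -/
def accPlus (a : Set Ordinal.{u}) : Set Ordinal.{u} :=
  {α | α < strictSup a ∧ sSup (a ∩ Iio α) = α ∧ 0 < α}

/-- `acc(a) = a ∩ acc⁺(a)`. For a cardinal `κ`, seen as the set `Iio κ.ord` of the ordinals below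
it, this gives the nonzero limit ordinals below `κ`. -/
def accPoints (a : Set Ordinal.{u}) : Set Ordinal.{u} :=
  a ∩ accPlus a

/-- `C` is a club (closed and cofinal subset) in the ordinal `o = {α | α < o}`. -/
def ClubIn (o : Ordinal.{u}) (C : Set Ordinal.{u}) : Prop :=
  C ⊆ Iio o ∧ IsClub ((↑) ⁻¹' C : Set (Iio o))

/-- `S` is a stationary subset of the ordinal `o = {α | α < o}`. -/
def StationaryIn (o : Ordinal.{u}) (S : Set Ordinal.{u}) : Prop :=
  S ⊆ Iio o ∧ IsStationary ((↑) ⁻¹' S : Set (Iio o))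

/-- `c` is a coloring `[κ]² → θ`. The color of `{α, β}` with `α < β < κ` is `c α β`; the values of
`c` at other pairs of ordinals are irrelevant. -/
def IsColoring (κ θ : Cardinal.{u}) (c : Ordinal.{u} → Ordinal.{u} → Ordinal.{u}) : Prop :=
  ∀ α β : Ordinal.{u}, α < β → β < κ.ord → c α β < θ.ord

/-- Subadditivity (of the first and of the second kind) of a coloring of `[κ]²`. -/
def IsSubadditive (κ : Cardinal.{u}) (c : Ordinal.{u} → Ordinal.{u} → Ordinal.{u}) : Prop :=
  ∀ α β γ : Ordinal.{u}, α < β → β < γ → γ < κ.ord →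
    c α γ ≤ max (c α β) (c β γ) ∧ c α β ≤ max (c α γ) (c β γ)

/-- `D^c_{≤ i}(β) = {α < β | c(α, β) ≤ i}`. -/
def levelSet (c : Ordinal.{u} → Ordinal.{u} → Ordinal.{u}) (i β : Ordinal.{u}) :
    Set Ordinal.{u} :=
  {α | α < β ∧ c α β ≤ i}

/-- The coloring `c : [κ]² → θ` is `Σ`-closed. -/
def IsClosedOn (κ θ : Cardinal.{u}) (c : Ordinal.{u} → Ordinal.{u} → Ordinal.{u})
    (Sig : Set Ordinal.{u}) : Prop :=
  ∀ β i : Ordinal.{u}, β < κ.ord → i ≤ θ.ord → accPlus (levelSet c i β) ∩ Sig ⊆ levelSet c i β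

/-- The coloring `c : [κ]² → θ` is closed, that is, `κ`-closed. -/
def IsClosedColoring (κ θ : Cardinal.{u}) (c : Ordinal.{u} → Ordinal.{u} → Ordinal.{u}) : Prop :=
  IsClosedOn κ θ c (Iio κ.ord)

/-- The coloring `c : [κ]² → θ` witnesses `U(κ, μ, θ, χ)`: for every cardinal `σ < χ`, every
pairwise disjoint `𝒜 ⊆ [κ]^σ` of size `κ` and every `i < θ`, there is `ℬ ∈ [𝒜]^μ` such that all
colors in `c[a × b]` are greater than `i`, whenever `{a, b} ∈ [ℬ]²` and `a < b`, i.e. every element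
of `a` is smaller than every element of `b`. -/
def WitnessesU (κ μ θ χ : Cardinal.{u}) (c : Ordinal.{u} → Ordinal.{u} → Ordinal.{u}) : Prop :=
  ∀ σ : Cardinal.{u}, σ < χ →
  ∀ 𝒜 : Set (Set Ordinal.{u}),
    (∀ a ∈ 𝒜, a ⊆ Iio κ.ord ∧ #a = Cardinal.lift.{u + 1} σ) →
    𝒜.PairwiseDisjoint id →
    #𝒜 = Cardinal.lift.{u + 1} κ →
  ∀ i : Ordinal.{u}, i < θ.ord →
  ∃ ℬ : Set (Set Ordinal.{u}), ℬ ⊆ 𝒜 ∧ #ℬ = Cardinal.lift.{u + 1} μ ∧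
    ∀ a ∈ ℬ, ∀ b ∈ ℬ, a ≠ b → (∀ α ∈ a, ∀ β ∈ b, α < β) →
      ∀ α ∈ a, ∀ β ∈ b, i < c α β

/-- The matrix `⟨C α i | α ∈ Γ, start α ≤ i < θ⟩` is a `⊟^ind(κ, θ)`-sequence. The values of `start`
and `C` at other arguments are irrelevant. -/
structure IsWeakIndexedSquareSeq (κ θ : Cardinal.{u}) (Γ : Set Ordinal.{u})
    (start : Ordinal.{u} → Ordinal.{u}) (C : Ordinal.{u} → Ordinal.{u} → Set Ordinal.{u}) :
    Prop where
  /-- `E^κ_{≠ θ} ∩ acc(κ) ⊆ Γ` -/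
  mem_of_cof_ne : ∀ α ∈ accPoints (Iio κ.ord), α.cof ≠ θ → α ∈ Γ
  subset_acc : Γ ⊆ accPoints (Iio κ.ord)
  start_lt : ∀ α ∈ Γ, start α < θ.ord
  club : ∀ α ∈ Γ, ∀ i, start α ≤ i → i < θ.ord → ClubIn α (C α i)
  mono : ∀ α ∈ Γ, ∀ i j, start α ≤ i → i ≤ j → j < θ.ord → C α i ⊆ C α j
  acc_union : ∀ α ∈ Γ, Γ ∩ Iio α = ⋃ i ∈ Ico (start α) θ.ord, accPoints (C α i)
  coherent : ∀ α ∈ Γ, ∀ i, start α ≤ i → i < θ.ord → ∀ β ∈ accPoints (C α i),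
    start β ≤ i ∧ C β i = C α i ∩ Iio β
  nontrivial : ∀ D, ClubIn κ.ord D →
    ∃ α ∈ accPoints D ∩ Γ, ∀ i, start α ≤ i → i < θ.ord → D ∩ Iio α ≠ C α i

/-- The weak indexed square principle `⊟^ind(κ, θ)`. -/
def WeakIndexedSquare (κ θ : Cardinal.{u}) : Prop :=
  ∃ (Γ : Set Ordinal.{u}) (start : Ordinal.{u} → Ordinal.{u})
    (C : Ordinal.{u} → Ordinal.{u} → Set Ordinal.{u}), IsWeakIndexedSquareSeq κ θ Γ start C

/-- `sup(Reg(κ))`, the supremum of the infinite regular cardinals below `κ`. -/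
noncomputable def supReg (κ : Cardinal.{u}) : Cardinal.{u} :=
  sSup {ν : Cardinal.{u} | ν.IsRegular ∧ ν < κ}

/-- There is a closed, subadditive witness to `U(κ, μ, θ, χ)`. -/
def HasClosedSubadditiveWitness (κ μ θ χ : Cardinal.{u}) : Prop :=
  ∃ c : Ordinal.{u} → Ordinal.{u} → Ordinal.{u},
    IsColoring κ θ c ∧ IsClosedColoring κ θ c ∧ IsSubadditive κ c ∧ WitnessesU κ μ θ χ c

/-!
# Weak indexed squares and closed subadditive colorings

The proof passes through one combinatorial property of a coloring `c : [κ]² → θ`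
(`NoUnboundedHomogeneous`): no unbounded subset of `κ` has all its colors bounded by some `i < θ`.

*From a square to a coloring.* On `Γ`, let the color of `α < β` be the least `i` for which `α` is an
accumulation point of `C β i`. Coherence of the matrix says exactly that this is subadditive, and
the level sets are the sets `acc (C β i)`, hence closed. Pulling it back along
`α ↦ min (Γ \ α)` gives a coloring of `[κ]²` (`squareColoring`). An unbounded set whose colors are
bounded by `i` makes the clubs `C α i` cohere to a club in `κ`, which nontriviality forbids.

*From no homogeneous set to `U(κ, κ, θ, sup Reg(κ))`.* Let `σ < ν < κ` with `ν` regular and `𝒜` a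
family of sets of size `σ`. Suppose that for stationarily many `δ` of cofinality `ν` some `a ∈ 𝒜`
above `δ` has `c δ β > i` for all `β ∈ a`. Closedness bounds every level set of such a `β` below
`δ`, uniformly in `β` as `σ < ν`, and pressing down yields the subfamily
(`exists_subfamily_of_stationary`). Otherwise, on an unbounded set the tree order
`c α β ≤ i` has its sets of predecessors covered by fewer than `ν` branches, and pressing down gives
an unbounded branch (`exists_unbounded_homogeneous`), a contradiction.

*From a coloring back to a square.* Take `Γ` to be the set of the `α` in which some level set is
cofinal, and let `C α i` be the `i`-th level set. If a club `D` were threaded, then a constant index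
would occur on an unbounded subset of `acc D`, and this subset would be homogeneous. This needs `Γ`
to meet the accumulation points of every club unboundedly often. As `Γ` contains all points of
cofinality different from `θ`, that is automatic unless `κ = ℵ₁` and `θ = ℵ₀`; in that case the
level sets may all be finite, but the square principle is provable outright by a recursion that
keeps every `acc (C α i)` finite (`weakIndexedSquare_aleph_one`).

*Stationary sets.* Given `S`, keep the clubs and, for a suitable `η ∈ Γ`, raise the starting index
at each `α > η` to the least `i` with `η ∈ acc (C α i)`. If no `η` worked, the diagonal intersection
of the resulting clubs would produce a homogeneous unbounded set.
-/

/-! ### Limit points, clubs and stationary sets -/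

/-- `δ` is a nonzero limit of elements of `a` below it. For `δ = κ.ord` this says that `a` is
unbounded in `κ`. -/
def IsLimPt (a : Set Ordinal.{u}) (δ : Ordinal.{u}) : Prop :=
  0 < δ ∧ ∀ ξ < δ, ∃ η ∈ a, ξ < η ∧ η < δ

theorem IsLimPt.mono {a b : Set Ordinal.{u}} {δ : Ordinal.{u}} (h : IsLimPt a δ) (hab : a ⊆ b) :
    IsLimPt b δ :=
  ⟨h.1, fun ξ hξ => let ⟨η, hη, h'⟩ := h.2 ξ hξ; ⟨η, hab hη, h'⟩⟩

theorem IsLimPt.inter_Iio {a : Set Ordinal.{u}} {δ β : Ordinal.{u}} (h : IsLimPt a δ)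
    (hβ : δ ≤ β) : IsLimPt (a ∩ Iio β) δ :=
  ⟨h.1, fun ξ hξ => let ⟨η, hη, h', h''⟩ := h.2 ξ hξ; ⟨η, ⟨hη, h''.trans_le hβ⟩, h', h''⟩⟩

theorem IsLimPt.isSuccLimit {a : Set Ordinal.{u}} {δ : Ordinal.{u}} (h : IsLimPt a δ) :
    Order.IsSuccLimit δ := by
  refine ⟨fun hm => hm.not_lt h.1, fun ξ hξ => ?_⟩
  obtain ⟨η, -, h1, h2⟩ := h.2 ξ hξ.lt
  exact hξ.2 h1 h2

theorem isLimPt_Iio {δ β : Ordinal.{u}} (h : Order.IsSuccLimit δ) (hβ : δ ≤ β) :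
    IsLimPt (Iio β) δ :=
  ⟨h.bot_lt, fun ξ hξ => ⟨ξ + 1, (h.add_one_lt hξ).trans_le hβ, lt_add_one ξ, h.add_one_lt hξ⟩⟩

theorem IsLimPt.of_limPt {a : Set Ordinal.{u}} {δ : Ordinal.{u}}
    (h : IsLimPt {ε | IsLimPt a ε} δ) : IsLimPt a δ := by
  refine ⟨h.1, fun ξ hξ => ?_⟩
  obtain ⟨η, hη, h1, h2⟩ := h.2 ξ hξ
  obtain ⟨ζ, hζ, h3, h4⟩ := hη.2 ξ h1
  exact ⟨ζ, hζ, h3, h4.trans h2⟩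

theorem isSuccLimit_ord_of_isRegular {κ : Cardinal.{u}} (hκ : κ.IsRegular) :
    Order.IsSuccLimit κ.ord :=
  isSuccLimit_ord hκ.aleph0_le

theorem mem_accPlus_iff {a : Set Ordinal.{u}} (ha : BddAbove a) {δ : Ordinal.{u}} :
    δ ∈ accPlus a ↔ (∃ ξ ∈ a, δ ≤ ξ) ∧ IsLimPt a δ := by
  have hb : BddAbove ((fun α => α + 1) '' a) := bddAbove_add_one_image_iff.2 ha
  have h1 : δ < strictSup a ↔ ∃ ξ ∈ a, δ ≤ ξ := by
    rw [strictSup, lt_csSup_iff' hb]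
    simp
  have hb' : BddAbove (a ∩ Iio δ) := ha.mono inter_subset_left
  rw [accPlus, mem_ofPred_eq, h1, IsLimPt]
  refine and_congr_right fun _ => ?_
  rw [and_comm]
  refine and_congr_right fun _ => ?_
  constructor
  · intro h ξ hξ
    rw [← h, lt_csSup_iff' hb'] at hξ
    obtain ⟨η, ⟨h1, h2⟩, h3⟩ := hξ
    exact ⟨η, h1, h3, h2⟩
  · intro h
    apply le_antisymm
    · exact csSup_le' fun x hx => hx.2.le
    · by_contra! hlt
      obtain ⟨η, h1, h2, h3⟩ := h _ hlt
      exact (le_csSup hb' ⟨h1, h3⟩).not_gt h2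

theorem mem_accPoints_Iio {κ : Cardinal.{u}} {δ : Ordinal.{u}} :
    δ ∈ accPoints (Iio κ.ord) ↔ δ < κ.ord ∧ Order.IsSuccLimit δ := by
  rw [accPoints, mem_inter_iff, mem_accPlus_iff bddAbove_Iio]
  constructor
  · rintro ⟨h1, -, h3⟩
    exact ⟨h1, h3.isSuccLimit⟩
  · rintro ⟨h1, h2⟩
    exact ⟨h1, ⟨δ, h1, le_rfl⟩, isLimPt_Iio h2 (le_of_lt h1)⟩

theorem clubIn_iff {o : Ordinal.{u}} (ho : Order.IsSuccLimit o) {C : Set Ordinal.{u}} :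
    ClubIn o C ↔ C ⊆ Iio o ∧ (∀ δ < o, IsLimPt C δ → δ ∈ C) ∧ IsLimPt C o := by
  rw [ClubIn, isClub_iff]
  refine and_congr_right fun hC => and_congr ?_ ?_
  · constructor
    · intro h δ hδ hl
      let x : Iio o := ⟨δ, hδ⟩
      have : x ∈ ((↑) ⁻¹' C : Set (Iio o)) := by
        refine h (d := {y : Iio o | (y : Ordinal) ∈ C ∧ (y : Ordinal) < δ})
          (fun y hy => hy.1) ?_ (.of_linearOrder _) ⟨fun y hy => hy.2.le, ?_⟩
        · obtain ⟨η, h1, -, h3⟩ := hl.2 0 hl.1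
          exact ⟨⟨η, hC h1⟩, h1, h3⟩
        · intro z hz
          by_contra! hlt
          obtain ⟨η, h1, h2, h3⟩ := hl.2 z hlt
          exact (hz (a := ⟨η, hC h1⟩) ⟨h1, h3⟩).not_gt h2
      exact this
    · intro h t ht hne _ x hx
      by_cases hxt : x ∈ t
      · exact ht hxt
      refine h x x.2 ⟨?_, fun ξ hξ => ?_⟩
      · obtain ⟨y, hy⟩ := hne
        exact zero_le.trans_lt (lt_of_le_of_ne (hx.1 hy) fun e => hxt (Subtype.ext e ▸ hy))
      · obtain ⟨y, hy, h1⟩ : ∃ y ∈ t, ξ < y := by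
          by_contra! hcon
          have : x ≤ ⟨ξ, hξ.trans x.2⟩ := hx.2 fun y hy => hcon y hy
          exact hξ.not_ge this
        exact ⟨y, ht hy, h1, lt_of_le_of_ne (hx.1 hy) fun e => hxt (by
          have : y = x := Subtype.ext e
          rwa [← this])⟩
  · constructor
    · intro h
      refine ⟨ho.bot_lt, fun ξ hξ => ?_⟩
      obtain ⟨y, hy, h1⟩ := h ⟨ξ + 1, ho.add_one_lt hξ⟩
      exact ⟨y, hy, (lt_add_one ξ).trans_le h1, y.2⟩
    · intro h x
      obtain ⟨η, h1, h2, h3⟩ := h.2 x x.2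
      exact ⟨⟨η, h3⟩, h1, h2.le⟩

theorem ClubIn.mem_accPoints_iff {o : Ordinal.{u}} (ho : Order.IsSuccLimit o)
    {C : Set Ordinal.{u}} (hC : ClubIn o C) {δ : Ordinal.{u}} :
    δ ∈ accPoints C ↔ δ < o ∧ IsLimPt C δ := by
  obtain ⟨h1, h2, h3⟩ := (clubIn_iff ho).1 hC
  rw [accPoints, mem_inter_iff, mem_accPlus_iff (bddAbove_Iio.mono h1)]
  constructor
  · rintro ⟨h4, -, h5⟩
    exact ⟨h1 h4, h5⟩
  · rintro ⟨h4, h5⟩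
    exact ⟨h2 _ h4 h5, ⟨δ, h2 _ h4 h5, le_rfl⟩, h5⟩

theorem stationaryIn_iff {o : Ordinal.{u}} {S : Set Ordinal.{u}} :
    StationaryIn o S ↔ S ⊆ Iio o ∧ ∀ C, ClubIn o C → ∃ δ ∈ S, δ ∈ C := by
  refine and_congr_right fun _ => ⟨fun h C hC => ?_, fun h t ht => ?_⟩
  · obtain ⟨x, h1, h2⟩ := h hC.2
    exact ⟨x, h1, h2⟩
  · obtain ⟨δ, h1, ⟨x, h2, rfl⟩⟩ := h ((↑) '' t)
      ⟨by rintro _ ⟨x, -, rfl⟩; exact x.2, by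
        rwa [preimage_image_eq _ Subtype.val_injective]⟩
    exact ⟨x, h1, h2⟩

/-- A family of fewer than `cof o` ordinals below `o` has an upper bound below `o`. -/
theorem exists_lt_forall_le {ι : Type (u + 1)} {o : Ordinal.{u}}
    (hι : #ι < Cardinal.lift.{u + 1} o.cof) (f : ι → Ordinal.{u}) (hf : ∀ i, f i < o) :
    ∃ b < o, ∀ i, f i ≤ b := by
  refine ⟨⨆ i, f i, lift_iSup_lt_of_lt_cof ?_ hf, fun i => le_ciSup ⟨o, ?_⟩ i⟩
  · rwa [← lift_cof, Cardinal.lift_id'.{u, u + 1}]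
  · rintro _ ⟨i, rfl⟩
    exact (hf i).le

theorem mk_Iio_ord_lift (κ : Cardinal.{u}) : #(Iio κ.ord) = Cardinal.lift.{u + 1} κ := by
  rw [Cardinal.mk_Iio_ordinal, card_ord]

section Regular

variable {κ : Cardinal.{u}} (hκ : κ.IsRegular)
include hκ

/-- The pigeonhole principle: a partition of an unbounded subset of `κ` into `θ < κ` pieces has an
unbounded piece. -/
theorem exists_isLimPt_fiber {θ : Cardinal.{u}} (hθκ : θ < κ) {A : Set Ordinal.{u}}
    (hA : IsLimPt A κ.ord) (f : Ordinal.{u} → Ordinal.{u}) (hf : ∀ α ∈ A, α < κ.ord → f α < θ.ord) :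
    ∃ i < θ.ord, IsLimPt {α ∈ A | f α = i} κ.ord := by
  by_contra! hcon
  have h1 : ∀ i : Iio θ.ord, ∃ b < κ.ord, ∀ α ∈ A, α < κ.ord → f α = i → α ≤ b := by
    intro i
    have := hcon i i.2
    simp only [IsLimPt, hA.1, true_and, not_forall] at this
    obtain ⟨b, hb, h⟩ := this
    refine ⟨b, hb, fun α hα hακ hi => ?_⟩
    by_contra! hlt
    exact h ⟨α, ⟨hα, hi⟩, hlt, hακ⟩
  choose b hb hb' using h1
  obtain ⟨B, hB, hB'⟩ := exists_lt_forall_le (o := κ.ord)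
    (by rw [hκ.cof_ord, mk_Iio_ord_lift]; exact Cardinal.lift_lt.2 hθκ) b hb
  obtain ⟨α, hα, h2, h3⟩ := hA.2 B hB
  exact ((hb' ⟨f α, hf α hα h3⟩ α hα h3 rfl).trans (hB' _)).not_gt h2

theorem mk_eq_iff_isLimPt {A : Set Ordinal.{u}} (hA : A ⊆ Iio κ.ord) :
    #A = Cardinal.lift.{u + 1} κ ↔ IsLimPt A κ.ord := by
  constructor
  · intro h
    refine ⟨hκ.ord_pos, fun ξ hξ => ?_⟩
    by_contra! hcon
    have h1 : A ⊆ Iio (ξ + 1) := fun α hα => by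
      by_contra! h2
      have h3 : ξ < α := by
        rw [mem_Iio, Order.lt_add_one_iff, not_le] at h2
        exact h2
      exact (hcon α hα h3).not_gt (hA hα)
    have h2 := mk_le_mk_of_subset h1
    rw [h, Cardinal.mk_Iio_ordinal, Cardinal.lift_le, ← ord_le] at h2
    exact h2.not_gt ((isSuccLimit_ord_of_isRegular hκ).add_one_lt hξ)
  · intro h
    apply le_antisymm
    · rw [← mk_Iio_ord_lift]
      exact mk_le_mk_of_subset hA
    · by_contra! hlt
      obtain ⟨b, hb, hb'⟩ := exists_lt_forall_le (o := κ.ord) (ι := A) (by rwa [hκ.cof_ord])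
        (fun x => x) (fun x => hA x.2)
      obtain ⟨η, h1, h2, h3⟩ := h.2 b hb
      exact (hb' ⟨η, h1⟩).not_gt h2

/-- A club in `κ` has points of every regular cofinality `ν < κ`: enumerate it increasingly and take the
`(ξ + ν)`-th element. -/
theorem ClubIn.exists_cof_eq {C : Set Ordinal.{u}} (hC : ClubIn κ.ord C) {ν : Cardinal.{u}}
    (hν : ν.IsRegular) (hνκ : ν < κ) {ξ : Ordinal.{u}} (hξ : ξ < κ.ord) :
    ∃ δ ∈ C, ξ < δ ∧ δ.cof = ν ∧ IsLimPt C δ := by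
  have hlim := isSuccLimit_ord_of_isRegular hκ
  obtain ⟨c1, c2, c3⟩ := (clubIn_iff hlim).1 hC
  -- adding all ordinals from `κ` on makes `enumOrd` applicable without changing the first `κ` values
  set s : Set Ordinal.{u} := C ∪ Ici κ.ord with hs
  have hs' : ¬ BddAbove s := fun h => not_bddAbove_Ici κ.ord (h.mono subset_union_right)
  have hn : Order.IsNormal (enumOrd s) := by
    refine isNormal_enumOrd (fun t ht hne hb => ?_) hs'
    by_cases hk : κ.ord ≤ sSup t
    · exact Or.inr hk
    push Not at hk
    by_cases hmem : sSup t ∈ t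
    · exact ht hmem
    refine Or.inl (c2 _ hk ⟨?_, fun ζ hζ => ?_⟩)
    · obtain ⟨x, hx⟩ := hne
      exact zero_le.trans_lt (lt_of_le_of_ne (le_csSup hb hx) fun e => hmem (e ▸ hx))
    · obtain ⟨y, hy, h1⟩ := (lt_csSup_iff' hb).1 hζ
      have h2 := le_csSup hb hy
      refine ⟨y, ?_, h1, lt_of_le_of_ne h2 fun e => hmem (e ▸ hy)⟩
      exact (ht hy).resolve_right fun h => (h.trans h2).not_gt hk
  have hlt : ∀ ι < κ.ord, enumOrd s ι < κ.ord := by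
    intro ι hι
    obtain ⟨b, hb, hb'⟩ : ∃ b < κ.ord, ∀ j : Iio ι, enumOrd s j < κ.ord → enumOrd s j ≤ b := by
      obtain ⟨b, hb, hb'⟩ := exists_lt_forall_le (o := κ.ord) (ι := Iio ι)
        (by rw [hκ.cof_ord, Cardinal.mk_Iio_ordinal, Cardinal.lift_lt, ← lt_ord]; exact hι)
        (fun j => if enumOrd s j < κ.ord then enumOrd s j else 0)
        (fun j => by split_ifs with h; exacts [h, hκ.ord_pos])
      refine ⟨b, hb, fun j hj => ?_⟩
      have := hb' j
      rwa [if_pos hj] at this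
    obtain ⟨η, h1, h2, h3⟩ := c3.2 b hb
    obtain ⟨k, hk⟩ := enumOrd_surjective hs' (b := η) (Or.inl h1)
    by_contra! hcon
    have h4 : k < ι := (enumOrd_lt_enumOrd hs').1 (by rw [hk]; exact h3.trans_le hcon)
    have := hb' ⟨k, h4⟩ (by simpa [hk] using h3)
    simp only [hk] at this
    exact this.not_gt h2
  have hνl : Order.IsSuccLimit ν.ord := isSuccLimit_ord_of_isRegular hν
  have hνl' : Order.IsSuccLimit (ξ + ν.ord) := isSuccLimit_add ξ hνl
  have hsum : ξ + ν.ord < κ.ord :=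
    isPrincipal_add_ord hκ.aleph0_le hξ (ord_lt_ord.2 hνκ)
  have hξ' : ξ < ξ + ν.ord := by simpa using hν.ord_pos
  have hd : enumOrd s (ξ + ν.ord) < κ.ord := hlt _ hsum
  have hmem : ∀ ι, enumOrd s ι < κ.ord → enumOrd s ι ∈ C := fun ι hι =>
    (enumOrd_mem hs' ι).resolve_right fun h => h.not_gt hι
  refine ⟨enumOrd s (ξ + ν.ord), hmem _ hd, hξ'.trans_le (le_enumOrd_self hs'), ?_, ?_⟩
  · rw [cof_map_of_isNormal hn hνl', cof_add _ hν.ord_pos.ne', hν.cof_ord]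
  · refine ⟨zero_le.trans_lt (hξ'.trans_le (le_enumOrd_self hs')), fun ζ hζ => ?_⟩
    obtain ⟨ι, h1, h2⟩ := (hn.lt_iff_exists_lt hνl').1 hζ
    have h3 := enumOrd_strictMono hs' h1
    exact ⟨enumOrd s ι, hmem _ (h3.trans hd), h2, h3⟩

variable (hκ' : ℵ₀ < κ)
include hκ'

theorem clubIn_closurePoints (g : Ordinal.{u} → Ordinal.{u}) (hg : ∀ ξ < κ.ord, g ξ < κ.ord) :
    ClubIn κ.ord {δ | δ < κ.ord ∧ 0 < δ ∧ ∀ ξ < δ, g ξ < δ} := by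
  rw [clubIn_iff (isSuccLimit_ord_of_isRegular hκ)]
  refine ⟨fun δ hδ => hδ.1, fun δ hδ hl => ⟨hδ, hl.1, fun ξ hξ => ?_⟩, hκ.ord_pos, fun ξ hξ => ?_⟩
  · obtain ⟨η, h1, h2, h3⟩ := hl.2 ξ hξ
    exact (h1.2.2 ξ h2).trans h3
  · -- majorize `g` by a function `f` that is progressive and dominates all earlier values of `g`
    have hf : ∀ ξ, ∃ b, (ξ < κ.ord → b < κ.ord) ∧ ∀ ζ ≤ ξ, ξ < κ.ord → g ζ < b ∧ ζ < b := by
      intro ξ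
      by_cases hξ : ξ < κ.ord
      swap
      · exact ⟨0, fun h => absurd h hξ, fun _ _ h => absurd h hξ⟩
      have hlim := isSuccLimit_ord_of_isRegular hκ
      obtain ⟨b, hb, hb'⟩ := exists_lt_forall_le (o := κ.ord) (ι := Iio (ξ + 1))
        (by
          rw [hκ.cof_ord, Cardinal.mk_Iio_ordinal, Cardinal.lift_lt, ← lt_ord]
          exact hlim.add_one_lt hξ)
        (fun ζ => max (g ζ) ζ) (fun ζ => by
          have : (ζ : Ordinal) < κ.ord := lt_of_lt_of_le ζ.2 (hlim.add_one_lt hξ).le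
          exact max_lt (hg _ this) this)
      refine ⟨b + 1, fun _ => hlim.add_one_lt hb, fun ζ hζ _ => ?_⟩
      have h1 := hb' ⟨ζ, Order.lt_add_one_iff.2 hζ⟩
      rw [max_le_iff] at h1
      exact ⟨Order.lt_add_one_iff.2 h1.1, Order.lt_add_one_iff.2 h1.2⟩
    choose f hf1 hf2 using hf
    have hlt : nfp f (ξ + 1) < κ.ord :=
      nfp_lt_ord (by rwa [hκ.cof_ord]) hf1 ((isSuccLimit_ord_of_isRegular hκ).add_one_lt hξ)
    have hξ' : ξ < nfp f (ξ + 1) := (lt_add_one ξ).trans_le (le_nfp f _)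
    refine ⟨nfp f (ξ + 1), ⟨hlt, zero_le.trans_lt hξ', fun ζ hζ => ?_⟩, hξ', hlt⟩
    obtain ⟨n, hn⟩ := lt_nfp_iff.1 hζ
    refine ((hf2 _ ζ hn.le ((iterate_le_nfp f _ n).trans_lt hlt)).1).trans_le ?_
    have := iterate_le_nfp f (ξ + 1) (n + 1)
    rwa [Function.iterate_succ_apply'] at this

theorem ClubIn.inter {C D : Set Ordinal.{u}} (hC : ClubIn κ.ord C) (hD : ClubIn κ.ord D) :
    ClubIn κ.ord (C ∩ D) := by
  refine ⟨inter_subset_left.trans hC.1, ?_⟩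
  rw [preimage_inter]
  refine IsClub.inter ?_ hC.2 hD.2
  rw [cof_Iio, ← lift_cof, hκ.cof_ord]
  intro h
  rw [Cardinal.lift_eq_aleph0] at h
  exact hκ'.ne' h

theorem clubIn_limPts {X : Set Ordinal.{u}} (hX : IsLimPt X κ.ord) :
    ClubIn κ.ord {δ | δ < κ.ord ∧ IsLimPt X δ} := by
  have hlim := isSuccLimit_ord_of_isRegular hκ
  rw [clubIn_iff hlim]
  refine ⟨fun δ hδ => hδ.1, fun δ hδ hl => ⟨hδ, (hl.mono fun ε hε => hε.2).of_limPt⟩, ?_⟩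
  choose! g h1 h2 h3 using hX.2
  refine ((clubIn_iff hlim).1 (clubIn_closurePoints hκ hκ' g h3)).2.2.mono ?_
  rintro δ ⟨h4, h5, h6⟩
  exact ⟨h4, h5, fun ξ hξ => ⟨g ξ, h1 ξ (hξ.trans h4), h2 ξ (hξ.trans h4), h6 ξ hξ⟩⟩

/-- Diagonal intersections of clubs contain clubs. -/
theorem exists_clubIn_diagonal {D : Ordinal.{u} → Set Ordinal.{u}}
    (hD : ∀ η < κ.ord, ClubIn κ.ord (D η)) :
    ∃ E, ClubIn κ.ord E ∧ ∀ δ ∈ E, ∀ η < δ, δ ∈ D η := by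
  have hlim := isSuccLimit_ord_of_isRegular hκ
  have hn : ∀ η ξ, ∃ ζ, η < κ.ord → ξ < κ.ord → ζ ∈ D η ∧ ξ < ζ ∧ ζ < κ.ord := by
    intro η ξ
    by_cases h : η < κ.ord ∧ ξ < κ.ord
    · obtain ⟨ζ, hζ⟩ := ((clubIn_iff hlim).1 (hD η h.1)).2.2.2 ξ h.2
      exact ⟨ζ, fun _ _ => hζ⟩
    · exact ⟨0, fun h1 h2 => absurd ⟨h1, h2⟩ h⟩
  choose h hh using hn
  have hg : ∀ ξ, ∃ b, ξ < κ.ord → b < κ.ord ∧ ∀ η ≤ ξ, h η ξ ≤ b := by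
    intro ξ
    by_cases hξ : ξ < κ.ord
    swap
    · exact ⟨0, fun h => absurd h hξ⟩
    obtain ⟨b, hb, hb'⟩ := exists_lt_forall_le (o := κ.ord) (ι := Iio (ξ + 1))
      (by
        rw [hκ.cof_ord, Cardinal.mk_Iio_ordinal, Cardinal.lift_lt, ← lt_ord]
        exact hlim.add_one_lt hξ)
      (fun η => h η ξ) (fun η =>
        (hh η ξ (lt_of_lt_of_le η.2 (hlim.add_one_lt hξ).le) hξ).2.2)
    exact ⟨b, fun _ => ⟨hb, fun η hη => hb' ⟨η, Order.lt_add_one_iff.2 hη⟩⟩⟩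
  choose g hg' using hg
  refine ⟨_, clubIn_closurePoints hκ hκ' g fun ξ hξ => (hg' ξ hξ).1, ?_⟩
  rintro δ ⟨h1, h2, h3⟩ η hη
  refine ((clubIn_iff hlim).1 (hD η (hη.trans h1))).2.1 δ h1 ⟨h2, fun ξ hξ => ?_⟩
  have hm : max η ξ < δ := max_lt hη hξ
  obtain ⟨h4, h5, h6⟩ := hh η (max η ξ) (hη.trans h1) (hm.trans h1)
  exact ⟨_, h4, (le_max_right _ _).trans_lt h5,
    ((hg' _ (hm.trans h1)).2 η (le_max_left _ _)).trans_lt (h3 _ hm)⟩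

theorem StationaryIn.isLimPt {S : Set Ordinal.{u}} (hS : StationaryIn κ.ord S) :
    IsLimPt S κ.ord := by
  refine ⟨hκ.ord_pos, fun ξ hξ => ?_⟩
  obtain ⟨δ, h1, h2⟩ := (stationaryIn_iff.1 hS).2 _
    (clubIn_closurePoints hκ hκ' (fun _ => ξ) fun _ _ => hξ)
  exact ⟨δ, h1, h2.2.2 0 h2.2.1, h2.1⟩

theorem StationaryIn.inter_clubIn {S C : Set Ordinal.{u}} (hS : StationaryIn κ.ord S)
    (hC : ClubIn κ.ord C) : StationaryIn κ.ord (S ∩ C) := by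
  rw [stationaryIn_iff] at hS ⊢
  refine ⟨inter_subset_left.trans hS.1, fun E hE => ?_⟩
  obtain ⟨δ, h1, h2, h3⟩ := hS.2 _ (ClubIn.inter hκ hκ' hC hE)
  exact ⟨δ, ⟨h1, h2⟩, h3⟩

/-- The form of Fodor's lemma used here: a regressive function on a stationary set is constant on an
unbounded set. If every fiber were bounded, the points closed under the bounds would form a club
disjoint from the set. -/
theorem StationaryIn.exists_isLimPt_fiber {S : Set Ordinal.{u}} (hS : StationaryIn κ.ord S)
    (f : Ordinal.{u} → Ordinal.{u}) (hf : ∀ δ ∈ S, f δ < δ) :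
    ∃ ε < κ.ord, IsLimPt {δ ∈ S | f δ = ε} κ.ord := by
  by_contra! hcon
  have h1 : ∀ ε < κ.ord, ∃ b < κ.ord, ∀ δ ∈ S, f δ = ε → δ ≤ b := by
    intro ε hε
    have := hcon ε hε
    simp only [IsLimPt, hκ.ord_pos, true_and, not_forall] at this
    obtain ⟨b, hb, h⟩ := this
    refine ⟨b, hb, fun α hα hi => ?_⟩
    by_contra! hlt
    exact h ⟨α, ⟨hα, hi⟩, hlt, hS.1 hα⟩
  choose! b hb hb' using h1
  obtain ⟨δ, h2, h3⟩ := (stationaryIn_iff.1 hS).2 _ (clubIn_closurePoints hκ hκ' b hb)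
  exact (hb' (f δ) ((hf δ h2).trans h3.1) δ h2 rfl).not_gt (h3.2.2 _ (hf δ h2))

theorem stationaryIn_cof {C : Set Ordinal.{u}} (hC : ClubIn κ.ord C) {ν : Cardinal.{u}}
    (hν : ν.IsRegular) (hνκ : ν < κ) : StationaryIn κ.ord {δ ∈ C | δ.cof = ν} := by
  rw [stationaryIn_iff]
  refine ⟨fun δ hδ => hC.1 hδ.1, fun E hE => ?_⟩
  obtain ⟨δ, h1, -, h2, -⟩ :=
    (ClubIn.inter hκ hκ' hC hE).exists_cof_eq hκ hν hνκ hκ.ord_pos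
  exact ⟨δ, ⟨h1.1, h2⟩, h1.2⟩

end Regular

/-! ### From square sequences to colorings -/

/-- The level set `{α < β | c α β ≤ i}` is closed below `β`. This is stronger than
`IsClosedColoring`, whose condition `acc⁺(D) ⊆ D` says nothing about the supremum of `D`; the
difference matters when a level set is cofinal in some `δ < β` and has no elements above `δ`. -/
def IsStronglyClosed (κ θ : Cardinal.{u}) (c : Ordinal.{u} → Ordinal.{u} → Ordinal.{u}) : Prop :=
  ∀ β < κ.ord, ∀ i < θ.ord, ∀ δ < β, IsLimPt (levelSet c i β) δ → c δ β ≤ i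

/-- No unbounded subset of `κ` has all its colors bounded by some `i < θ`. -/
def NoUnboundedHomogeneous (κ θ : Cardinal.{u}) (c : Ordinal.{u} → Ordinal.{u} → Ordinal.{u}) :
    Prop :=
  ∀ H ⊆ Iio κ.ord, IsLimPt H κ.ord → ∀ i < θ.ord, ∃ α ∈ H, ∃ β ∈ H, α < β ∧ i < c α β

theorem bddAbove_levelSet (c : Ordinal.{u} → Ordinal.{u} → Ordinal.{u}) (i β : Ordinal.{u}) :
    BddAbove (levelSet c i β) :=
  ⟨β, fun _ h => h.1.le⟩

theorem IsStronglyClosed.isClosedColoring {κ θ : Cardinal.{u}}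
    {c : Ordinal.{u} → Ordinal.{u} → Ordinal.{u}} (hc : IsStronglyClosed κ θ c)
    (hcol : IsColoring κ θ c) : IsClosedColoring κ θ c := by
  rintro β i hβ hi δ ⟨hδ, -⟩
  obtain ⟨⟨ξ, hξ, h1⟩, h2⟩ := (mem_accPlus_iff (bddAbove_levelSet c i β)).1 hδ
  have hlt : δ < β := h1.trans_lt hξ.1
  refine ⟨hlt, ?_⟩
  rcases hi.lt_or_eq with hi | rfl
  · exact hc β hβ i hi δ hlt h2
  · exact (hcol δ β hlt hβ).le

namespace IsWeakIndexedSquareSeq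

variable {κ θ : Cardinal.{u}} {Γ : Set Ordinal.{u}} {start : Ordinal.{u} → Ordinal.{u}}
  {C : Ordinal.{u} → Ordinal.{u} → Set Ordinal.{u}} (h : IsWeakIndexedSquareSeq κ θ Γ start C)
include h

theorem lt_ord {α : Ordinal.{u}} (hα : α ∈ Γ) : α < κ.ord :=
  (mem_accPoints_Iio.1 (h.subset_acc hα)).1

theorem isSuccLimit {α : Ordinal.{u}} (hα : α ∈ Γ) : Order.IsSuccLimit α :=
  (mem_accPoints_Iio.1 (h.subset_acc hα)).2

theorem mem_accPoints_iff {α β i : Ordinal.{u}} (hα : α ∈ Γ) (hi : start α ≤ i) (hi' : i < θ.ord) :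
    β ∈ accPoints (C α i) ↔ β < α ∧ IsLimPt (C α i) β :=
  (h.club α hα i hi hi').mem_accPoints_iff (h.isSuccLimit hα)

theorem mem_of_mem_accPoints {α β i : Ordinal.{u}} (hα : α ∈ Γ) (hi : start α ≤ i)
    (hi' : i < θ.ord) (hβ : β ∈ accPoints (C α i)) : β ∈ Γ := by
  have : β ∈ Γ ∩ Iio α := by
    rw [h.acc_union α hα]
    exact mem_biUnion (x := i) ⟨hi, hi'⟩ hβ
  exact this.1

theorem accPoints_mono {α i j : Ordinal.{u}} (hα : α ∈ Γ) (hi : start α ≤ i) (hij : i ≤ j)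
    (hj : j < θ.ord) : accPoints (C α i) ⊆ accPoints (C α j) := by
  intro β hβ
  rw [h.mem_accPoints_iff hα hi (hij.trans_lt hj)] at hβ
  rw [h.mem_accPoints_iff hα (hi.trans hij) hj]
  exact ⟨hβ.1, hβ.2.mono (h.mono α hα i j hi hij hj)⟩

theorem exists_mem_accPoints {α β : Ordinal.{u}} (hα : α ∈ Γ) (hβ : β ∈ Γ) (hβα : β < α) :
    ∃ i, start α ≤ i ∧ i < θ.ord ∧ β ∈ accPoints (C α i) := by
  have : β ∈ Γ ∩ Iio α := ⟨hβ, hβα⟩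
  rw [h.acc_union α hα] at this
  simp only [mem_iUnion] at this
  obtain ⟨i, hi, hi'⟩ := this
  exact ⟨i, hi.1, hi.2, hi'⟩

theorem accPoints_eq {α β i : Ordinal.{u}} (hα : α ∈ Γ) (hi : start α ≤ i)
    (hi' : i < θ.ord) (hβ : β ∈ accPoints (C α i)) {γ : Ordinal.{u}} (hγ : γ < β) :
    γ ∈ accPoints (C β i) ↔ γ ∈ accPoints (C α i) := by
  obtain ⟨h1, h2⟩ := h.coherent α hα i hi hi' β hβ
  have hβΓ := h.mem_of_mem_accPoints hα hi hi' hβ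
  rw [h.mem_accPoints_iff hα hi hi'] at hβ
  rw [h.mem_accPoints_iff hα hi hi', h.mem_accPoints_iff hβΓ h1 hi', h2]
  exact ⟨fun h3 => ⟨hγ.trans hβ.1, h3.2.mono inter_subset_left⟩,
    fun h3 => ⟨hγ, h3.2.inter_Iio hγ.le⟩⟩

/-- An unbounded subset of `Γ` that coheres at one index `i` would have the union of its clubs
`C β i` as a thread. -/
theorem not_isLimPt_of_forall_mem_accPoints (hκ : κ.IsRegular)
    {H : Set Ordinal.{u}} (hH : H ⊆ Γ) {i : Ordinal.{u}} (hi : i < θ.ord)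
    (hc : ∀ β ∈ H, ∀ α ∈ H, α < β → start β ≤ i ∧ α ∈ accPoints (C β i)) :
    ¬ IsLimPt H κ.ord := by
  intro hlim
  have hko := isSuccLimit_ord_of_isRegular hκ
  -- only the least element `β` of `H` may fail `start β ≤ i`
  have hgood : ∀ ξ < κ.ord, ∃ β ∈ H, ξ < β ∧ start β ≤ i := by
    intro ξ hξ
    obtain ⟨α, h1, h2, h3⟩ := hlim.2 ξ hξ
    obtain ⟨β, h4, h5, -⟩ := hlim.2 α h3
    exact ⟨β, h4, h2.trans h5, (hc β h4 α h1 h5).1⟩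
  set D : Set Ordinal.{u} := {ξ | ∃ β ∈ H, start β ≤ i ∧ ξ ∈ C β i} with hD
  have hDβ : ∀ β ∈ H, start β ≤ i → D ∩ Iio β = C β i := by
    intro β hβ hs
    ext ξ
    constructor
    · rintro ⟨⟨γ, hγ, hγs, hξ⟩, hξβ⟩
      rcases lt_trichotomy γ β with hlt | rfl | hlt
      · have := (h.coherent β (hH hβ) i hs hi γ (hc β hβ γ hγ hlt).2).2
        rw [this] at hξ
        exact hξ.1
      · exact hξ
      · have := (h.coherent γ (hH hγ) i hγs hi β (hc γ hγ β hβ hlt).2).2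
        rw [this]
        exact ⟨hξ, hξβ⟩
    · intro hξ
      exact ⟨⟨β, hβ, hs, hξ⟩, (h.club β (hH hβ) i hs hi).1 hξ⟩
  have hacc : ∀ δ, IsLimPt D δ → δ < κ.ord → ∃ β ∈ H, start β ≤ i ∧ δ ∈ accPoints (C β i) := by
    intro δ hδ hδκ
    obtain ⟨β, hβ, hlt, hs⟩ := hgood δ hδκ
    refine ⟨β, hβ, hs, ?_⟩
    rw [h.mem_accPoints_iff (hH hβ) hs hi, ← hDβ β hβ hs]
    exact ⟨hlt, hδ.inter_Iio hlt.le⟩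
  have hclub : ClubIn κ.ord D := by
    rw [clubIn_iff hko]
    refine ⟨?_, fun δ hδ hl => ?_, hκ.ord_pos, fun ξ hξ => ?_⟩
    · rintro ξ ⟨β, hβ, hs, hξ⟩
      exact lt_trans ((h.club β (hH hβ) i hs hi).1 hξ) (h.lt_ord (hH hβ))
    · obtain ⟨β, hβ, hs, hm⟩ := hacc δ hl hδ
      exact ⟨β, hβ, hs, hm.1⟩
    · obtain ⟨β, hβ, hlt, hs⟩ := hgood ξ hξ
      obtain ⟨η, h1, h2, h3⟩ :=
        ((clubIn_iff (h.isSuccLimit (hH hβ))).1 (h.club β (hH hβ) i hs hi)).2.2.2 ξ hlt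
      exact ⟨η, ⟨β, hβ, hs, h1⟩, h2, h3.trans (h.lt_ord (hH hβ))⟩
  obtain ⟨α, ⟨hα, hαΓ⟩, hne⟩ := h.nontrivial D hclub
  rw [hclub.mem_accPoints_iff hko] at hα
  obtain ⟨β, hβ, hs, hm⟩ := hacc α hα.2 hα.1
  obtain ⟨h1, h2⟩ := h.coherent β (hH hβ) i hs hi α hm
  refine hne i h1 hi ?_
  have hlt := ((h.mem_accPoints_iff (hH hβ) hs hi).1 hm).1
  rw [h2, ← hDβ β hβ hs, inter_assoc, Iio_inter_Iio, min_eq_right hlt.le]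

theorem isLimPt_ord (hκ : κ.IsRegular) (hκ' : ℵ₀ < κ) : IsLimPt Γ κ.ord := by
  have hko := isSuccLimit_ord_of_isRegular hκ
  refine ⟨hκ.ord_pos, fun ξ hξ => ?_⟩
  have hclub := clubIn_closurePoints hκ hκ' (fun _ => ξ) fun _ _ => hξ
  obtain ⟨α, ⟨hα, hαΓ⟩, -⟩ := h.nontrivial _ hclub
  exact ⟨α, hαΓ, hα.1.2.2 0 hα.1.2.1, h.lt_ord hαΓ⟩

end IsWeakIndexedSquareSeq

/-- The least index at which `α` is an accumulation point of the `β`-th row. -/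
noncomputable def accIndex (θ : Cardinal.{u}) (start : Ordinal.{u} → Ordinal.{u})
    (C : Ordinal.{u} → Ordinal.{u} → Set Ordinal.{u}) (α β : Ordinal.{u}) : Ordinal.{u} :=
  sInf {i | start β ≤ i ∧ i < θ.ord ∧ α ∈ accPoints (C β i)}

/-- The least element of `Γ` that is at least `α`. -/
noncomputable def nextIn (Γ : Set Ordinal.{u}) (α : Ordinal.{u}) : Ordinal.{u} :=
  sInf {γ | γ ∈ Γ ∧ α ≤ γ}

open Classical in
/-- The coloring `accIndex` of pairs from `Γ`, pulled back to all pairs along `nextIn Γ`. Pairs that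
are mapped to the same point get color `0`. -/
noncomputable def squareColoring (θ : Cardinal.{u}) (Γ : Set Ordinal.{u})
    (start : Ordinal.{u} → Ordinal.{u}) (C : Ordinal.{u} → Ordinal.{u} → Set Ordinal.{u})
    (α β : Ordinal.{u}) : Ordinal.{u} :=
  if nextIn Γ α = nextIn Γ β then 0 else accIndex θ start C (nextIn Γ α) (nextIn Γ β)

section nextIn

variable {κ : Cardinal.{u}} {Γ : Set Ordinal.{u}} (hΓ : IsLimPt Γ κ.ord)
include hΓ

theorem nextIn_spec {α : Ordinal.{u}} (hα : α < κ.ord) : nextIn Γ α ∈ Γ ∧ α ≤ nextIn Γ α := by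
  obtain ⟨γ, h1, h2, h3⟩ := hΓ.2 α hα
  exact csInf_mem (s := {γ | γ ∈ Γ ∧ α ≤ γ}) ⟨γ, h1, h2.le⟩

omit hΓ in
theorem nextIn_le {α γ : Ordinal.{u}} (hγ : γ ∈ Γ) (h : α ≤ γ) : nextIn Γ α ≤ γ :=
  csInf_le' ⟨hγ, h⟩

theorem nextIn_mono {α β : Ordinal.{u}} (hαβ : α ≤ β) (hβ : β < κ.ord) :
    nextIn Γ α ≤ nextIn Γ β :=
  nextIn_le (nextIn_spec hΓ hβ).1 (hαβ.trans (nextIn_spec hΓ hβ).2)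

end nextIn

namespace IsWeakIndexedSquareSeq

variable {κ θ : Cardinal.{u}} {Γ : Set Ordinal.{u}} {start : Ordinal.{u} → Ordinal.{u}}
  {C : Ordinal.{u} → Ordinal.{u} → Set Ordinal.{u}} (h : IsWeakIndexedSquareSeq κ θ Γ start C)
include h

theorem accIndex_spec {α β : Ordinal.{u}} (hα : α ∈ Γ) (hβ : β ∈ Γ) (hαβ : α < β) :
    start β ≤ accIndex θ start C α β ∧ accIndex θ start C α β < θ.ord ∧
      α ∈ accPoints (C β (accIndex θ start C α β)) :=
  csInf_mem (s := {i | start β ≤ i ∧ i < θ.ord ∧ α ∈ accPoints (C β i)})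
    (h.exists_mem_accPoints hβ hα hαβ)

theorem accIndex_le_iff {α β i : Ordinal.{u}} (hα : α ∈ Γ) (hβ : β ∈ Γ) (hαβ : α < β)
    (hi : i < θ.ord) :
    accIndex θ start C α β ≤ i ↔ start β ≤ i ∧ α ∈ accPoints (C β i) := by
  obtain ⟨h1, h2, h3⟩ := h.accIndex_spec hα hβ hαβ
  refine ⟨fun hle => ⟨h1.trans hle, h.accPoints_mono hβ h1 hle hi h3⟩, fun h4 => ?_⟩
  exact csInf_le' ⟨h4.1, hi, h4.2⟩

theorem accIndex_subadditive {α β γ : Ordinal.{u}} (hα : α ∈ Γ) (hβ : β ∈ Γ) (hγ : γ ∈ Γ)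
    (hαβ : α < β) (hβγ : β < γ) :
    accIndex θ start C α γ ≤ max (accIndex θ start C α β) (accIndex θ start C β γ) ∧
      accIndex θ start C α β ≤ max (accIndex θ start C α γ) (accIndex θ start C β γ) := by
  have hαγ := hαβ.trans hβγ
  have l1 := (h.accIndex_spec hα hβ hαβ).2.1
  have l2 := (h.accIndex_spec hβ hγ hβγ).2.1
  have l3 := (h.accIndex_spec hα hγ hαγ).2.1
  constructor
  · have hk := max_lt l1 l2
    obtain ⟨h1, h2⟩ := (h.accIndex_le_iff hα hβ hαβ hk).1 (le_max_left _ _)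
    obtain ⟨h3, h4⟩ := (h.accIndex_le_iff hβ hγ hβγ hk).1 (le_max_right _ _)
    exact (h.accIndex_le_iff hα hγ hαγ hk).2 ⟨h3, (h.accPoints_eq hγ h3 hk h4 hαβ).1 h2⟩
  · have hk := max_lt l3 l2
    obtain ⟨h1, h2⟩ := (h.accIndex_le_iff hα hγ hαγ hk).1 (le_max_left _ _)
    obtain ⟨h3, h4⟩ := (h.accIndex_le_iff hβ hγ hβγ hk).1 (le_max_right _ _)
    exact (h.accIndex_le_iff hα hβ hαβ hk).2
      ⟨(h.coherent γ hγ _ h3 hk β h4).1, (h.accPoints_eq hγ h3 hk h4 hαβ).2 h2⟩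

variable (hκ : κ.IsRegular) (hθ : θ.IsRegular) (hκ' : ℵ₀ < κ)
include hκ hκ' hθ

theorem isColoring_squareColoring : IsColoring κ θ (squareColoring θ Γ start C) := by
  have hΓ := h.isLimPt_ord hκ hκ'
  intro α β hαβ hβ
  rw [squareColoring]
  split_ifs with he
  · exact hθ.ord_pos
  · exact (h.accIndex_spec (nextIn_spec hΓ (hαβ.trans hβ)).1 (nextIn_spec hΓ hβ).1
      (lt_of_le_of_ne (nextIn_mono hΓ hαβ.le hβ) he)).2.1

omit hθ in
theorem isSubadditive_squareColoring : IsSubadditive κ (squareColoring θ Γ start C) := by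
  have hΓ := h.isLimPt_ord hκ hκ'
  intro α β γ hαβ hβγ hγ
  have hβ := hβγ.trans hγ
  have h1 := nextIn_mono hΓ hαβ.le hβ
  have h2 := nextIn_mono hΓ hβγ.le hγ
  have h3 : ∀ {a}, a < κ.ord → nextIn Γ a ∈ Γ := fun ha => (nextIn_spec hΓ ha).1
  rcases h1.eq_or_lt with e1 | l1
  · simp [squareColoring, e1]
  rcases h2.eq_or_lt with e2 | l2
  · simp [squareColoring, ← e2]
  simp only [squareColoring, l1.ne, l2.ne, (l1.trans l2).ne, if_false]
  exact h.accIndex_subadditive (h3 (hαβ.trans hβ)) (h3 hβ) (h3 hγ) l1 l2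

omit hθ in
theorem isStronglyClosed_squareColoring : IsStronglyClosed κ θ (squareColoring θ Γ start C) := by
  have hΓ := h.isLimPt_ord hκ hκ'
  have h3 : ∀ {a}, a < κ.ord → nextIn Γ a ∈ Γ := fun ha => (nextIn_spec hΓ ha).1
  have h4 : ∀ {a}, a < κ.ord → a ≤ nextIn Γ a := fun ha => (nextIn_spec hΓ ha).2
  intro β hβ i hi δ hδβ hl
  have hδ := hδβ.trans hβ
  rcases (nextIn_mono hΓ hδβ.le hβ).eq_or_lt with e | l
  · simp [squareColoring, e]
  -- if some `α < δ` of small color has the same successor in `Γ` as `δ`, there is nothing to do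
  by_cases hc : ∃ α ∈ levelSet (squareColoring θ Γ start C) i β, α < δ ∧ nextIn Γ α = nextIn Γ δ
  · obtain ⟨α, h5, -, h7⟩ := hc
    have := h5.2
    rwa [squareColoring, h7] at this
  push Not at hc
  have hlt : ∀ α ∈ levelSet (squareColoring θ Γ start C) i β, α < δ → nextIn Γ α < δ := by
    intro α h5 h6
    by_contra! h7
    exact hc α h5 h6 (le_antisymm (nextIn_mono hΓ h6.le hδ)
      (nextIn_le (h3 (h6.trans hδ)) h7))
  have hacc : start (nextIn Γ β) ≤ i ∧ ∀ ξ < δ, ∃ γ ∈ accPoints (C (nextIn Γ β) i),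
      ξ < γ ∧ γ < δ := by
    have hm : ∀ α ∈ levelSet (squareColoring θ Γ start C) i β, α < δ →
        start (nextIn Γ β) ≤ i ∧ nextIn Γ α ∈ accPoints (C (nextIn Γ β) i) := by
      intro α h5 h6
      have h7 : nextIn Γ α < nextIn Γ β := ((hlt α h5 h6).trans hδβ).trans_le (h4 hβ)
      have := h5.2
      rw [squareColoring, if_neg h7.ne] at this
      exact (h.accIndex_le_iff (h3 (h6.trans hδ)) (h3 hβ) h7 hi).1 this
    constructor
    · obtain ⟨α, h5, -, h6⟩ := hl.2 0 hl.1
      exact (hm α h5 h6).1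
    · intro ξ hξ
      obtain ⟨α, h5, h6, h7⟩ := hl.2 ξ hξ
      exact ⟨_, (hm α h5 h7).2, h6.trans_le (h4 (h7.trans hδ)), hlt α h5 h7⟩
  have hmem : δ ∈ accPoints (C (nextIn Γ β) i) := by
    rw [h.mem_accPoints_iff (h3 hβ) hacc.1 hi]
    refine ⟨hδβ.trans_le (h4 hβ), hl.1, fun ξ hξ => ?_⟩
    obtain ⟨γ, h5, h6⟩ := hacc.2 ξ hξ
    exact ⟨γ, h5.1, h6⟩
  have hδΓ := h.mem_of_mem_accPoints (h3 hβ) hacc.1 hi hmem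
  have he : nextIn Γ δ = δ := le_antisymm (nextIn_le hδΓ le_rfl) (h4 hδ)
  rw [squareColoring, if_neg l.ne, he]
  exact (h.accIndex_le_iff hδΓ (h3 hβ) (hδβ.trans_le (h4 hβ)) hi).2 ⟨hacc.1, hmem⟩

omit hθ in
theorem noUnboundedHomogeneous_squareColoring :
    NoUnboundedHomogeneous κ θ (squareColoring θ Γ start C) := by
  have hΓ := h.isLimPt_ord hκ hκ'
  have h3 : ∀ {a}, a < κ.ord → nextIn Γ a ∈ Γ := fun ha => (nextIn_spec hΓ ha).1
  have h4 : ∀ {a}, a < κ.ord → a ≤ nextIn Γ a := fun ha => (nextIn_spec hΓ ha).2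
  intro H hH hlim i hi
  by_contra! hcon
  refine h.not_isLimPt_of_forall_mem_accPoints hκ (H := nextIn Γ '' H) (i := i) ?_ hi ?_ ?_
  · rintro _ ⟨α, hα, rfl⟩
    exact h3 (hH hα)
  · rintro _ ⟨β, hβ, rfl⟩ _ ⟨α, hα, rfl⟩ hlt
    have hαβ : α < β := by
      by_contra! hle
      exact (nextIn_mono hΓ hle (hH hα)).not_gt hlt
    have := hcon α hα β hβ hαβ
    rw [squareColoring, if_neg hlt.ne] at this
    exact (h.accIndex_le_iff (h3 (hH hα)) (h3 (hH hβ)) hlt hi).1 this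
  · refine ⟨hκ.ord_pos, fun ξ hξ => ?_⟩
    obtain ⟨α, h5, h6, h7⟩ := hlim.2 ξ hξ
    exact ⟨_, ⟨α, h5, rfl⟩, h6.trans_le (h4 h7), h.lt_ord (h3 h7)⟩

end IsWeakIndexedSquareSeq

/-! ### From colorings to square sequences -/

/-- Apply the principle to the family of singletons. -/
theorem WitnessesU.noUnboundedHomogeneous {κ θ : Cardinal.{u}} (hκ : κ.IsRegular)
    {c : Ordinal.{u} → Ordinal.{u} → Ordinal.{u}} (hc : WitnessesU κ 2 θ 2 c) :
    NoUnboundedHomogeneous κ θ c := by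
  intro H hH hlim i hi
  obtain ⟨ℬ, h1, h2, h3⟩ := hc 1 one_lt_two ((fun α => {α}) '' H) (by
      rintro _ ⟨α, hα, rfl⟩
      exact ⟨singleton_subset_iff.2 (hH hα), by simp⟩) (by
      rintro _ ⟨α, hα, rfl⟩ _ ⟨β, hβ, rfl⟩ hne
      simp only [Function.onFun, id, disjoint_singleton]
      rintro rfl
      exact hne rfl) (by
      rw [mk_image_eq singleton_injective]
      exact (mk_eq_iff_isLimPt hκ hH).2 hlim) i hi
  rw [Cardinal.lift_ofNat, mk_eq_two_iff] at h2
  obtain ⟨⟨a, ha⟩, ⟨b, hb⟩, hab, -⟩ := h2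
  rw [ne_eq, Subtype.mk.injEq] at hab
  obtain ⟨α, hα, rfl⟩ := h1 ha
  obtain ⟨β, hβ, rfl⟩ := h1 hb
  have hne : α ≠ β := fun e => hab (by rw [e])
  rcases hne.lt_or_gt with hlt | hlt
  · exact ⟨α, hα, β, hβ, hlt, h3 {α} ha {β} hb hab (by simpa) α rfl β rfl⟩
  · exact ⟨β, hβ, α, hα, hlt, h3 {β} hb {α} ha (Ne.symm hab) (by simpa) β rfl α rfl⟩

/-- The limit ordinals below `κ` in which some level set of `c` is cofinal. -/
def cofinalLevels (κ θ : Cardinal.{u}) (c : Ordinal.{u} → Ordinal.{u} → Ordinal.{u}) :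
    Set Ordinal.{u} :=
  {α | α < κ.ord ∧ ∃ i < θ.ord, IsLimPt (levelSet c i α) α}

/-- The least `i` for which the level set `{ξ < α | c ξ α ≤ i}` is cofinal in `α`. -/
noncomputable def cofinalStart (c : Ordinal.{u} → Ordinal.{u} → Ordinal.{u}) (α : Ordinal.{u}) :
    Ordinal.{u} :=
  sInf {i | IsLimPt (levelSet c i α) α}

theorem levelSet_mono {c : Ordinal.{u} → Ordinal.{u} → Ordinal.{u}} {i j β : Ordinal.{u}}
    (h : i ≤ j) : levelSet c i β ⊆ levelSet c j β :=
  fun _ h' => ⟨h'.1, h'.2.trans h⟩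

theorem IsSubadditive.levelSet_eq {κ : Cardinal.{u}}
    {c : Ordinal.{u} → Ordinal.{u} → Ordinal.{u}} (hc : IsSubadditive κ c) {β α i : Ordinal.{u}}
    (hα : α < κ.ord) (hβ : β ∈ levelSet c i α) : levelSet c i β = levelSet c i α ∩ Iio β := by
  ext ξ
  constructor
  · rintro ⟨h1, h2⟩
    exact ⟨⟨h1.trans hβ.1, ((hc ξ β α h1 hβ.1 hα).1).trans (max_le h2 hβ.2)⟩, h1⟩
  · rintro ⟨⟨h1, h2⟩, h3⟩
    exact ⟨h3, ((hc ξ β α h3 hβ.1 hα).2).trans (max_le h2 hβ.2)⟩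

section

variable {κ θ : Cardinal.{u}} {c : Ordinal.{u} → Ordinal.{u} → Ordinal.{u}}

theorem isLimPt_cofinalStart {α : Ordinal.{u}} (h : α ∈ cofinalLevels κ θ c) :
    IsLimPt (levelSet c (cofinalStart c α) α) α := by
  obtain ⟨-, i, -, hi⟩ := h
  exact csInf_mem (s := {i | IsLimPt (levelSet c i α) α}) ⟨i, hi⟩

theorem cofinalStart_le_iff {α i : Ordinal.{u}} (h : α ∈ cofinalLevels κ θ c) :
    cofinalStart c α ≤ i ↔ IsLimPt (levelSet c i α) α :=
  ⟨fun hi => (isLimPt_cofinalStart h).mono (levelSet_mono hi), fun hi => csInf_le' hi⟩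

theorem clubIn_levelSet (hcl : IsClosedColoring κ θ c) {α i : Ordinal.{u}} (hα : α < κ.ord)
    (hi : i < θ.ord) (hl : IsLimPt (levelSet c i α) α) : ClubIn α (levelSet c i α) := by
  rw [clubIn_iff hl.isSuccLimit]
  refine ⟨fun ξ hξ => hξ.1, fun δ hδ hδl => hcl α i hα hi.le ⟨?_, hδ.trans hα⟩, hl⟩
  rw [mem_accPlus_iff (bddAbove_levelSet c i α)]
  obtain ⟨η, h1, h2, -⟩ := hl.2 δ hδ
  exact ⟨⟨η, h1, h2.le⟩, hδl⟩

/-- The level sets of `α` are an increasing union of length `θ` with value `α`; unless `cof α = θ`, one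
of them is already cofinal. -/
theorem mem_cofinalLevels_of_cof_ne (hθ : θ.IsRegular) (hcol : IsColoring κ θ c) {α : Ordinal.{u}}
    (hα : α < κ.ord) (hlim : Order.IsSuccLimit α) (hcof : α.cof ≠ θ) :
    α ∈ cofinalLevels κ θ c := by
  refine ⟨hα, ?_⟩
  rcases hcof.lt_or_gt with hlt | hlt
  · -- the colors along a short cofinal subset of `α` are bounded below `θ`
    obtain ⟨s, hs, hs'⟩ := Order.exists_cof_eq (Iio α)
    rw [cof_Iio, ← lift_cof] at hs'
    obtain ⟨i, hi, hi'⟩ := exists_lt_forall_le (o := θ.ord) (ι := s)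
      (by rw [hs', hθ.cof_ord]; exact Cardinal.lift_lt.2 hlt)
      (fun ξ => c ξ α) (fun ξ => hcol _ _ ξ.1.2 hα)
    refine ⟨i, hi, hlim.bot_lt, fun ξ hξ => ?_⟩
    obtain ⟨η, h1, h2⟩ := hs ⟨ξ + 1, hlim.add_one_lt hξ⟩
    exact ⟨η, ⟨η.2, hi' ⟨η, h1⟩⟩, (lt_add_one ξ).trans_le h2, η.2⟩
  · by_contra! hcon
    have h1 : ∀ i : Iio θ.ord, ∃ b < α, ∀ ξ < α, c ξ α ≤ i → ξ ≤ b := by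
      intro i
      have := hcon i i.2
      simp only [IsLimPt, show 0 < α from hlim.bot_lt, true_and, not_forall] at this
      obtain ⟨b, hb, h⟩ := this
      refine ⟨b, hb, fun ξ hξ hi => ?_⟩
      by_contra! hlt
      exact h ⟨ξ, ⟨hξ, hi⟩, hlt, hξ⟩
    choose b hb hb' using h1
    obtain ⟨B, hB, hB'⟩ := exists_lt_forall_le (o := α)
      (by rw [mk_Iio_ord_lift]; exact Cardinal.lift_lt.2 hlt) b hb
    have hB1 := hlim.add_one_lt hB
    exact ((hb' ⟨_, hcol _ _ hB1 hα⟩ _ hB1 le_rfl).trans (hB' _)).not_gt (lt_add_one B)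

/-- The level sets of a coloring without unbounded homogeneous sets form a square sequence. The regular
cardinal `ν ≠ θ` makes `Γ` large: it contains all points of cofinality `ν`. -/
theorem isWeakIndexedSquareSeq_levelSet (hκ : κ.IsRegular) (hθ : θ.IsRegular) (hθκ : θ < κ)
    {ν : Cardinal.{u}} (hν : ν.IsRegular) (hνκ : ν < κ) (hνθ : ν ≠ θ)
    (hcol : IsColoring κ θ c) (hcl : IsClosedColoring κ θ c)
    (hsub : IsSubadditive κ c) (hno : NoUnboundedHomogeneous κ θ c) :
    IsWeakIndexedSquareSeq κ θ (cofinalLevels κ θ c) (cofinalStart c) (fun α i => levelSet c i α) := by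
  have hclub : ∀ α ∈ cofinalLevels κ θ c, ∀ i, cofinalStart c α ≤ i → i < θ.ord →
      ClubIn α (levelSet c i α) := fun α hα i hi hi' =>
    clubIn_levelSet hcl hα.1 hi' ((cofinalStart_le_iff hα).1 hi)
  have hacc : ∀ α ∈ cofinalLevels κ θ c, ∀ i, cofinalStart c α ≤ i → i < θ.ord →
      ∀ β ∈ accPoints (levelSet c i α), β ∈ cofinalLevels κ θ c ∧ cofinalStart c β ≤ i ∧
        levelSet c i β = levelSet c i α ∩ Iio β := by
    intro α hα i hi hi' β hβ
    have he := hsub.levelSet_eq hα.1 hβ.1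
    have h1 := ((hclub α hα i hi hi').mem_accPoints_iff (isLimPt_cofinalStart hα).isSuccLimit).1 hβ
    have h2 : IsLimPt (levelSet c i β) β := he ▸ h1.2.inter_Iio le_rfl
    have h3 : β ∈ cofinalLevels κ θ c := ⟨h1.1.trans hα.1, i, hi', h2⟩
    exact ⟨h3, (cofinalStart_le_iff h3).2 h2, he⟩
  refine ⟨fun α hα hcof => ?_, fun α hα => ?_, fun α hα => ?_, hclub,
    fun α _ i j _ hij _ => levelSet_mono hij, fun α hα => ?_,
    fun α hα i hi hi' β hβ => (hacc α hα i hi hi' β hβ).2, fun D hD => ?_⟩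
  · rw [mem_accPoints_Iio] at hα
    exact mem_cofinalLevels_of_cof_ne hθ hcol hα.1 hα.2 hcof
  · exact mem_accPoints_Iio.2 ⟨hα.1, (isLimPt_cofinalStart hα).isSuccLimit⟩
  · obtain ⟨i, hi, hi'⟩ := hα.2
    exact ((cofinalStart_le_iff hα).2 hi').trans_lt hi
  · obtain ⟨i₀, hi₀, hi₀'⟩ := hα.2
    have hs := ((cofinalStart_le_iff hα).2 hi₀').trans_lt hi₀
    ext β
    simp only [mem_iUnion]
    constructor
    · rintro ⟨hβ, hβα⟩
      obtain ⟨j, hj, hj'⟩ := hβ.2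
      have hsβ := ((cofinalStart_le_iff hβ).2 hj').trans_lt hj
      -- an index for which both rows are defined and that bounds the color of the pair
      set i := max (c β α) (max (cofinalStart c β) (cofinalStart c α))
      have hi : i < θ.ord := max_lt (hcol _ _ hβα hα.1) (max_lt hsβ hs)
      have hi1 : cofinalStart c β ≤ i := (le_max_left _ _).trans (le_max_right _ _)
      have hi2 : cofinalStart c α ≤ i := (le_max_right _ _).trans (le_max_right _ _)
      refine ⟨i, ⟨hi2, hi⟩, ?_⟩
      rw [(hclub α hα i hi2 hi).mem_accPoints_iff (isLimPt_cofinalStart hα).isSuccLimit]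
      refine ⟨hβα, IsLimPt.mono ((cofinalStart_le_iff hβ).1 hi1) ?_⟩
      rw [hsub.levelSet_eq hα.1 (show β ∈ levelSet c i α from ⟨hβα, le_max_left _ _⟩)]
      exact inter_subset_left
    · rintro ⟨i, hi, hβ⟩
      exact ⟨(hacc α hα i hi.1 hi.2 β hβ).1, hβ.1.1⟩
  · by_contra! hcon
    have hko := isSuccLimit_ord_of_isRegular hκ
    choose! f hf1 hf2 hf3 using hcon
    have hA : IsLimPt (accPoints D ∩ cofinalLevels κ θ c) κ.ord := by
      refine ⟨hκ.ord_pos, fun ξ hξ => ?_⟩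
      obtain ⟨δ, h1, h2, h3, h4⟩ := hD.exists_cof_eq hκ hν hνκ hξ
      have hδ : δ < κ.ord := hD.1 h1
      exact ⟨δ, ⟨(hD.mem_accPoints_iff hko).2 ⟨hδ, h4⟩, mem_cofinalLevels_of_cof_ne hθ hcol hδ
        h4.isSuccLimit (by rwa [h3])⟩, h2, hδ⟩
    obtain ⟨i, hi, hi'⟩ := exists_isLimPt_fiber hκ hθκ hA f fun α hα _ => hf2 α hα
    obtain ⟨α, hα, β, hβ, hαβ, hlt⟩ := hno _ (fun α hα => hα.1.2.1) hi' i hi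
    have h1 : α ∈ D ∩ Iio β := ⟨hα.1.1.1, hαβ⟩
    rw [hf3 β hβ.1, hβ.2] at h1
    exact h1.2.not_gt hlt

end

/-! ### The square principle on the first uncountable cardinal -/

/-- The conditions on a row `d = (start, C)` at `α` of a matrix with countably many columns, whose
rows below `α` are given by `F`. -/
structure IsCountableRow (F : Ordinal.{u} → ℕ × (ℕ → Set Ordinal.{u})) (α : Ordinal.{u})
    (d : ℕ × (ℕ → Set Ordinal.{u})) : Prop where
  subset : ∀ n, d.1 ≤ n → d.2 n ⊆ Iio α
  isLimPt : ∀ n, d.1 ≤ n → IsLimPt (d.2 n) α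
  mono : ∀ m n, d.1 ≤ m → m ≤ n → d.2 m ⊆ d.2 n
  coherent : ∀ n, d.1 ≤ n → ∀ β < α, IsLimPt (d.2 n) β →
    β ∈ d.2 n ∧ (F β).1 ≤ n ∧ (F β).2 n = d.2 n ∩ Iio β
  exists_isLimPt : ∀ β < α, Order.IsSuccLimit β → ∃ n, d.1 ≤ n ∧ IsLimPt (d.2 n) β
  finite : ∀ n, d.1 ≤ n → {β | β < α ∧ IsLimPt (d.2 n) β}.Finite

theorem IsCountableRow.congr {F F' : Ordinal.{u} → ℕ × (ℕ → Set Ordinal.{u})} {α : Ordinal.{u}}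
    {d : ℕ × (ℕ → Set Ordinal.{u})} (h : IsCountableRow F α d) (hF : ∀ β < α, F β = F' β) :
    IsCountableRow F' α d :=
  ⟨h.subset, h.isLimPt, h.mono, fun n hn β hβ => hF β hβ ▸ h.coherent n hn β hβ,
    h.exists_isLimPt, h.finite⟩

/-- Stacking a cofinal set `E` with no limit points on top of a row at `β`. -/
theorem IsCountableRow.union {F : Ordinal.{u} → ℕ × (ℕ → Set Ordinal.{u})} {β : Ordinal.{u}}
    (h : IsCountableRow F β (F β)) {α : Ordinal.{u}} (hβ : Order.IsSuccLimit β)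
    (hβα : β < α) {E : Set Ordinal.{u}} (hE : E ⊆ Ico β α) (hβE : β ∈ E)
    (hElim : IsLimPt E α) (hE' : ∀ δ < α, ¬ IsLimPt E δ) {n : ℕ} (hn : (F β).1 ≤ n) :
    (F β).2 n ∪ E ⊆ Iio α ∧ IsLimPt ((F β).2 n ∪ E) α ∧
      (∀ δ < α, IsLimPt ((F β).2 n ∪ E) δ →
        δ ∈ (F β).2 n ∪ E ∧ (F δ).1 ≤ n ∧ (F δ).2 n = ((F β).2 n ∪ E) ∩ Iio δ) ∧
      {δ | δ < α ∧ IsLimPt ((F β).2 n ∪ E) δ}.Finite := by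
  have hsub := h.subset n hn
  have hle : ∀ δ < α, IsLimPt ((F β).2 n ∪ E) δ → δ = β ∨ δ < β ∧ IsLimPt ((F β).2 n) δ := by
    intro δ hδ hl
    rcases lt_trichotomy δ β with hlt | heq | hgt
    · refine Or.inr ⟨hlt, hl.1, fun ξ hξ => ?_⟩
      obtain ⟨η, h1 | h1, h2, h3⟩ := hl.2 ξ hξ
      · exact ⟨η, h1, h2, h3⟩
      · exact absurd (hE h1).1 (h3.trans hlt).not_ge
    · exact Or.inl heq
    · refine absurd ⟨hl.1, fun ξ hξ => ?_⟩ (hE' δ hδ)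
      obtain ⟨η, h1 | h1, h2, h3⟩ := hl.2 (max ξ β) (max_lt hξ hgt)
      · exact absurd (hsub h1) ((le_max_right ξ β).trans h2.le).not_gt
      · exact ⟨η, h1, (le_max_left _ _).trans_lt h2, h3⟩
  have hE0 : ∀ δ ≤ β, E ∩ Iio δ = ∅ := by
    intro δ hδ
    ext ξ
    simp only [mem_inter_iff, mem_Iio, mem_empty_iff_false, iff_false, not_and, not_lt]
    exact fun h1 => hδ.trans (hE h1).1
  refine ⟨?_, hElim.mono subset_union_right, fun δ hδ hl => ?_, ?_⟩
  · exact union_subset (hsub.trans (Iio_subset_Iio hβα.le)) (hE.trans Ico_subset_Iio_self)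
  · rcases hle δ hδ hl with rfl | ⟨hlt, hl'⟩
    · refine ⟨Or.inr hβE, hn, ?_⟩
      rw [union_inter_distrib_right, hE0 δ le_rfl, union_empty, inter_eq_left.2 hsub]
    · obtain ⟨h1, h2, h3⟩ := h.coherent n hn δ hlt hl'
      refine ⟨Or.inl h1, h2, ?_⟩
      rw [union_inter_distrib_right, hE0 δ hlt.le, union_empty, h3]
  · refine ((h.finite n hn).union (finite_singleton β)).subset ?_
    rintro δ ⟨hδ, hl⟩
    rcases hle δ hδ hl with rfl | h1
    · exact Or.inr rfl
    · exact Or.inl h1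

/-- A countable limit of elements of `X` is the limit of an increasing sequence in `X`. -/
theorem exists_strictMono_cofinal {X : Set Ordinal.{u}} {α : Ordinal.{u}} (hX : IsLimPt X α)
    (hα : α < (ℵ₁ : Cardinal.{u}).ord) :
    ∃ a : ℕ → Ordinal.{u}, StrictMono a ∧ (∀ n, a n ∈ X ∧ a n < α) ∧ ∀ ξ < α, ∃ n, ξ < a n := by
  have hc : (Iio α).Countable := by
    rw [← le_aleph0_iff_set_countable, Cardinal.mk_Iio_ordinal, Cardinal.lift_le_aleph0]
    rw [lt_ord, ← succ_aleph0, Order.lt_succ_iff] at hα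
    exact hα
  obtain ⟨e, he⟩ := hc.exists_eq_range ⟨0, hX.1⟩
  have heα : ∀ n, e n < α := fun n => by
    have : e n ∈ Iio α := he ▸ mem_range_self n
    exact this
  choose! g hg using hX.2
  let a : ℕ → Ordinal.{u} := fun n => n.rec (g 0) fun n x => g (max x (e n))
  have ha : ∀ n, a n ∈ X ∧ a n < α := by
    intro n
    induction n with
    | zero => exact ⟨(hg 0 hX.1).1, (hg 0 hX.1).2.2⟩
    | succ n ih =>
      have := hg _ (max_lt ih.2 (heα n))
      exact ⟨this.1, this.2.2⟩
  have hs : ∀ n, max (a n) (e n) < a (n + 1) := fun n => (hg _ (max_lt (ha n).2 (heα n))).2.1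
  refine ⟨a, strictMono_nat_of_lt_succ fun n => (le_max_left _ _).trans_lt (hs n), ha,
    fun ξ hξ => ?_⟩
  obtain ⟨n, rfl⟩ : ξ ∈ range e := he ▸ hξ
  exact ⟨n + 1, (le_max_right _ _).trans_lt (hs n)⟩

/-- At a limit `α` of limit ordinals choose limits `a m` increasing to `α`. The row at index `n` is the
row at `a k` topped with `a k, a (k + 1), …`, where `k ≤ n` is largest such that `a 0, …, a k` cohere
at index `n`. -/
theorem exists_isCountableRow_of_limit {F : Ordinal.{u} → ℕ × (ℕ → Set Ordinal.{u})}
    {α : Ordinal.{u}} (hα : α < (ℵ₁ : Cardinal.{u}).ord)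
    (hF : ∀ β < α, Order.IsSuccLimit β → IsCountableRow F β (F β))
    (hlim : IsLimPt {β | Order.IsSuccLimit β} α) : ∃ d, IsCountableRow F α d := by
  obtain ⟨a, hmono, haX, hcof⟩ := exists_strictMono_cofinal hlim hα
  have hrow : ∀ n, IsCountableRow F (a n) (F (a n)) := fun n => hF _ (haX n).2 (haX n).1
  have hj : ∀ n, ∃ j, (F (a (n + 1))).1 ≤ j ∧ IsLimPt ((F (a (n + 1))).2 j) (a n) := fun n =>
    (hrow (n + 1)).exists_isLimPt _ (hmono n.lt_succ_self) (haX n).1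
  choose j hj1 hj2 using hj
  -- `k n` is the length of the initial segment of the sequence that is coherent at the index `n`
  let k : ℕ → ℕ := fun n => Nat.findGreatest (fun k => ∀ m < k, j m ≤ n) n
  have hk : ∀ n, ∀ m < k n, j m ≤ n := fun n =>
    Nat.findGreatest_spec (P := fun k => ∀ m < k, j m ≤ n) (Nat.zero_le n)
      fun m hm => absurd hm (Nat.not_lt_zero m)
  have hkmono : ∀ m n, m ≤ n → k m ≤ k n := fun m n hmn =>
    Nat.le_findGreatest ((Nat.findGreatest_le m).trans hmn) fun l hl => (hk m l hl).trans hmn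
  have hkunb : ∀ K, ∃ N, ∀ n ≥ N, K ≤ k n := by
    intro K
    refine ⟨max K ((Finset.range K).sup j), fun n hn => Nat.le_findGreatest
      ((le_max_left _ _).trans hn) fun m hm => ?_⟩
    exact (Finset.le_sup (Finset.mem_range.2 hm)).trans ((le_max_right _ _).trans hn)
  have hstart : ∀ n, (F (a 0)).1 ≤ n → ∀ m ≤ k n, (F (a m)).1 ≤ n := by
    intro n hn m hm
    cases m with
    | zero => exact hn
    | succ m => exact (hj1 m).trans (hk n m hm)
  have hchain : ∀ n, (F (a 0)).1 ≤ n → ∀ m l, m < l → l ≤ k n →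
      IsLimPt ((F (a l)).2 n) (a m) := by
    intro n hn m l hml
    induction l, hml using Nat.le_induction with
    | base => exact fun hl => (hj2 m).mono ((hrow _).mono _ _ (hj1 m) (hk n m hl))
    | succ l hml ih =>
      intro hl
      have h1 : IsLimPt ((F (a (l + 1))).2 n) (a l) :=
        (hj2 l).mono ((hrow _).mono _ _ (hj1 l) (hk n l hl))
      have h2 := ((hrow (l + 1)).coherent n (hstart n hn _ hl) _ (hmono l.lt_succ_self) h1).2.2
      exact (ih (Nat.le_of_succ_le hl)).mono (h2 ▸ inter_subset_left)
  have hchain' : ∀ n, (F (a 0)).1 ≤ n → ∀ m l, m ≤ l → l ≤ k n →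
      (F (a m)).2 n ⊆ (F (a l)).2 n := by
    intro n hn m l hml hl
    rcases hml.eq_or_lt with rfl | hlt
    · exact Subset.rfl
    · rw [((hrow l).coherent n (hstart n hn l hl) _ (hmono hlt) (hchain n hn m l hlt hl)).2.2]
      exact inter_subset_left
  have hun : ∀ n, (F (a 0)).1 ≤ n → _ := fun n hn =>
    (hrow (k n)).union (haX (k n)).1 (haX (k n)).2 (E := a '' Ici (k n)) (n := n) (by
      rintro _ ⟨m, hm, rfl⟩
      exact ⟨hmono.monotone hm, (haX m).2⟩) ⟨k n, self_mem_Ici, rfl⟩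
      ⟨hlim.1, fun ξ hξ => by
        obtain ⟨m, hm⟩ := hcof ξ hξ
        exact ⟨a (max m (k n)), ⟨_, le_max_right m (k n), rfl⟩,
          hm.trans_le (hmono.monotone (le_max_left m (k n))), (haX _).2⟩⟩ (by
        intro δ hδ hl
        -- for the least `m` with `δ < a m`, no member of the sequence lies strictly between
        -- `a (m - 1)` and `δ` or, if these are equal, between `a (m - 2)` and `δ`
        obtain ⟨m, hm, hm'⟩ := Nat.findX (hcof δ hδ)
        cases m with
        | zero =>
          obtain ⟨_, ⟨l, -, rfl⟩, -, h1⟩ := hl.2 0 hl.1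
          exact (hm.trans_le (hmono.monotone (Nat.zero_le l))).not_gt h1
        | succ m =>
          rcases (not_lt.1 (hm' m m.lt_succ_self)).lt_or_eq with h1 | h1
          · obtain ⟨_, ⟨l, -, rfl⟩, h2, h3⟩ := hl.2 _ h1
            have h4 := hmono.lt_iff_lt.1 h2
            exact (hm.trans_le (hmono.monotone h4)).not_gt h3
          · cases m with
            | zero =>
              obtain ⟨_, ⟨l, -, rfl⟩, -, h3⟩ := hl.2 0 hl.1
              exact (h1.symm.le.trans (hmono.monotone (Nat.zero_le l))).not_gt h3
            | succ m =>
              obtain ⟨_, ⟨l, -, rfl⟩, h2, h3⟩ := hl.2 (a m) (h1 ▸ hmono m.lt_succ_self)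
              have h4 := hmono.lt_iff_lt.1 h2
              exact (h1.symm.le.trans (hmono.monotone h4)).not_gt h3) (hstart n hn _ le_rfl)
  refine ⟨⟨(F (a 0)).1, fun n => (F (a (k n))).2 n ∪ a '' Ici (k n)⟩,
    fun n hn => (hun n hn).1, fun n hn => (hun n hn).2.1, fun m n hm hmn => ?_,
    fun n hn => (hun n hn).2.2.1, fun β hβ hβlim => ?_, fun n hn => (hun n hn).2.2.2⟩
  · have hn := hm.trans hmn
    rintro ξ (hξ | ⟨l, hl, rfl⟩)
    · exact Or.inl (hchain' n hn _ _ (hkmono m n hmn) le_rfl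
        ((hrow _).mono m n (hstart m hm _ le_rfl) hmn hξ))
    · rcases lt_or_ge l (k n) with h1 | h1
      · exact Or.inl ((hrow _).coherent n (hstart n hn _ le_rfl) _ (hmono h1)
          (hchain n hn l _ h1 le_rfl)).1
      · exact Or.inr ⟨l, h1, rfl⟩
  · obtain ⟨m, hm⟩ := hcof β hβ
    obtain ⟨i, h1, h2⟩ := (hrow m).exists_isLimPt β hm hβlim
    obtain ⟨N, hN⟩ := hkunb m
    set n := max (max i N) (F (a 0)).1
    have hn : (F (a 0)).1 ≤ n := le_max_right _ _
    have hi : i ≤ n := (le_max_left _ _).trans (le_max_left _ _)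
    refine ⟨n, hn, h2.mono (subset_union_of_subset_left ?_ _)⟩
    exact ((hrow m).mono i n h1 hi).trans (hchain' n hn m _
      (hN n ((le_max_right _ _).trans (le_max_left _ _))) le_rfl)

/-- Every limit `α < ω₁` can be given a row. If `α` is not a limit of limits, add the interval `[β, α)` to the row of the largest
limit `β < α`, if there is one. -/
theorem exists_isCountableRow {F : Ordinal.{u} → ℕ × (ℕ → Set Ordinal.{u})}
    {α : Ordinal.{u}} (hα : α < (ℵ₁ : Cardinal.{u}).ord) (hαlim : Order.IsSuccLimit α)
    (hF : ∀ β < α, Order.IsSuccLimit β → IsCountableRow F β (F β)) :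
    ∃ d, IsCountableRow F α d := by
  by_cases hlim : IsLimPt {β | Order.IsSuccLimit β} α
  · exact exists_isCountableRow_of_limit hα hF hlim
  simp only [IsLimPt, show 0 < α from hαlim.bot_lt, true_and, not_forall] at hlim
  obtain ⟨ξ, hξ, hlim⟩ := hlim
  have hξ' : ∀ β < α, Order.IsSuccLimit β → β ≤ ξ := by
    intro β hβ hβl
    by_contra! hlt
    exact hlim ⟨β, hβl, hlt, hβ⟩
  by_cases hne : ∃ β < α, Order.IsSuccLimit β
  · -- `β` is the largest limit ordinal below `α`
    obtain ⟨β, hβα, hβ, hmax⟩ : ∃ β < α, Order.IsSuccLimit β ∧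
        ∀ γ < α, Order.IsSuccLimit γ → γ ≤ β := by
      set B := {β | β < α ∧ Order.IsSuccLimit β} with hB
      have hBb : BddAbove B := ⟨ξ, fun β hβ => hξ' β hβ.1 hβ.2⟩
      have hBne : B.Nonempty := hne
      have h1 : sSup B < α := (csSup_le' fun β hβ => hξ' β hβ.1 hβ.2).trans_lt hξ
      refine ⟨sSup B, h1, ?_, fun γ h2 h3 => le_csSup hBb ⟨h2, h3⟩⟩
      by_cases hmem : sSup B ∈ B
      · exact hmem.2
      · have : IsLimPt B (sSup B) := by
          obtain ⟨β, hβ⟩ := hBne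
          refine ⟨hβ.2.bot_lt.trans_le (le_csSup hBb hβ), fun ζ hζ => ?_⟩
          obtain ⟨γ, hγ, h2⟩ := (lt_csSup_iff' hBb).1 hζ
          exact ⟨γ, hγ, h2, lt_of_le_of_ne (le_csSup hBb hγ) fun e => hmem (e ▸ hγ)⟩
        exact this.isSuccLimit
    have hrow := hF β hβα hβ
    have hun : ∀ n, (F β).1 ≤ n → _ := fun n hn =>
      hrow.union hβ hβα (E := Ico β α) (n := n) Subset.rfl ⟨le_rfl, hβα⟩
        ⟨hαlim.bot_lt, fun ζ hζ => ⟨max ζ β + 1,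
          ⟨(le_max_right _ _).trans (lt_add_one _).le, hαlim.add_one_lt (max_lt hζ hβα)⟩,
          (le_max_left _ _).trans_lt (lt_add_one _), hαlim.add_one_lt (max_lt hζ hβα)⟩⟩ (by
        intro δ hδ hl
        have h1 := hmax δ hδ hl.isSuccLimit
        obtain ⟨η, h2, -, h3⟩ := hl.2 0 hl.1
        exact h2.1.not_gt (h3.trans_le h1)) hn
    refine ⟨⟨(F β).1, fun n => (F β).2 n ∪ Ico β α⟩,
      fun n hn => (hun n hn).1, fun n hn => (hun n hn).2.1,
      fun m n hm hmn => union_subset_union_left _ (hrow.mono m n hm hmn),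
      fun n hn => (hun n hn).2.2.1, fun γ hγ hγlim => ?_, fun n hn => (hun n hn).2.2.2⟩
    rcases (hmax γ hγ hγlim).eq_or_lt with rfl | hlt
    · exact ⟨_, le_rfl, (hrow.isLimPt _ le_rfl).mono subset_union_left⟩
    · obtain ⟨n, hn, hn'⟩ := hrow.exists_isLimPt γ hlt hγlim
      exact ⟨n, hn, hn'.mono subset_union_left⟩
  · push Not at hne
    refine ⟨⟨0, fun _ => Iio α⟩, fun _ _ => Subset.rfl, fun _ _ => isLimPt_Iio hαlim le_rfl,
      fun _ _ _ _ => Subset.rfl, fun _ _ β hβ hl => absurd hl.isSuccLimit (hne β hβ),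
      fun β hβ hl => absurd hl (hne β hβ), fun _ _ => ?_⟩
    convert finite_empty
    ext β
    simp only [mem_ofPred_eq, mem_empty_iff_false, iff_false, not_and]
    exact fun hβ hl => hne β hβ hl.isSuccLimit

/-- Rows are chosen by recursion; the conditions on the row at `α` only refer to the rows below. -/
theorem exists_forall_isCountableRow : ∃ F : Ordinal.{u} → ℕ × (ℕ → Set Ordinal.{u}),
    ∀ α < (ℵ₁ : Cardinal.{u}).ord, Order.IsSuccLimit α → IsCountableRow F α (F α) := by
  classical
  let ext (α : Ordinal.{u}) (p : ∀ β, β < α → ℕ × (ℕ → Set Ordinal.{u})) (β : Ordinal.{u}) :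
      ℕ × (ℕ → Set Ordinal.{u}) := if hβ : β < α then p β hβ else ⟨0, fun _ => ∅⟩
  let step (α : Ordinal.{u}) (p : ∀ β, β < α → ℕ × (ℕ → Set Ordinal.{u})) :
      ℕ × (ℕ → Set Ordinal.{u}) :=
    if h : ∃ d, IsCountableRow (ext α p) α d then h.choose else ⟨0, fun _ => ∅⟩
  let F : Ordinal.{u} → ℕ × (ℕ → Set Ordinal.{u}) := (wellFounded_lt (α := Ordinal.{u})).fix step
  have hFeq : ∀ α, F α = step α fun β _ => F β := fun α => WellFounded.fix_eq _ step α
  refine ⟨F, fun α => ?_⟩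
  induction α using WellFoundedLT.induction with
  | ind α ih =>
    intro hα hαlim
    have hext : ∀ β < α, ext α (fun β _ => F β) β = F β := fun β hβ => dif_pos hβ
    obtain ⟨d, hd⟩ := exists_isCountableRow hα hαlim fun β hβ => ih β hβ (hβ.trans hα)
    have h : ∃ d, IsCountableRow (ext α fun β _ => F β) α d :=
      ⟨d, hd.congr fun β hβ => (hext β hβ).symm⟩
    rw [show F α = h.choose by rw [hFeq]; exact dif_pos h]
    exact h.choose_spec.congr hext

theorem weakIndexedSquare_aleph_one : WeakIndexedSquare ℵ₁ (ℵ₀ : Cardinal.{u}) := by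
  obtain ⟨F, hF⟩ := exists_forall_isCountableRow.{u}
  have hreg := isRegular_aleph_one.{u}
  have hko := isSuccLimit_ord_of_isRegular hreg
  let C (α i : Ordinal.{u}) : Set Ordinal.{u} := ⋃ n ∈ {n : ℕ | (F α).1 ≤ n ∧ n ≤ i}, (F α).2 n
  set Γ : Set Ordinal.{u} := {α | α < (ℵ₁ : Cardinal.{u}).ord ∧ Order.IsSuccLimit α} with hΓ
  have hC : ∀ α ∈ Γ, ∀ n : ℕ, (F α).1 ≤ n → C α n = (F α).2 n := by
    intro α hα n hn
    ext ξ
    simp only [C, mem_iUnion]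
    constructor
    · rintro ⟨m, ⟨h1, h2⟩, h3⟩
      exact (hF α hα.1 hα.2).mono m n h1 (by exact_mod_cast h2) h3
    · exact fun h => ⟨n, ⟨hn, le_rfl⟩, h⟩
  have hnat : ∀ i < (ℵ₀ : Cardinal.{u}).ord, ∃ n : ℕ, i = n := by
    intro i hi
    rw [ord_aleph0] at hi
    exact lt_omega0.1 hi
  have hlt : ∀ n : ℕ, (n : Ordinal.{u}) < (ℵ₀ : Cardinal.{u}).ord := by
    intro n
    rw [ord_aleph0]
    exact natCast_lt_omega0 n
  have hclub : ∀ α ∈ Γ, ∀ n : ℕ, (F α).1 ≤ n → ClubIn α ((F α).2 n) := fun α hα n hn =>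
    (clubIn_iff hα.2).2 ⟨(hF α hα.1 hα.2).subset n hn,
      fun δ hδ hl => ((hF α hα.1 hα.2).coherent n hn δ hδ hl).1, (hF α hα.1 hα.2).isLimPt n hn⟩
  refine ⟨Γ, fun α => (F α).1, C, fun α hα _ => mem_accPoints_Iio.1 hα,
    fun α hα => mem_accPoints_Iio.2 hα, fun α _ => hlt _, fun α hα i hi hi' => ?_,
    fun α hα i j _ hij _ => ?_, fun α hα => ?_, fun α hα i hi hi' β hβ => ?_, fun D hD => ?_⟩
  · obtain ⟨n, rfl⟩ := hnat i hi'
    have hn : (F α).1 ≤ n := by exact_mod_cast hi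
    rw [hC α hα n hn]
    exact hclub α hα n hn
  · exact biUnion_subset_biUnion_left fun n hn => ⟨hn.1, hn.2.trans hij⟩
  · ext β
    simp only [mem_iUnion]
    constructor
    · rintro ⟨hβ, hβα⟩
      obtain ⟨n, hn, hn'⟩ := (hF α hα.1 hα.2).exists_isLimPt β hβα hβ.2
      refine ⟨n, ⟨by exact_mod_cast hn, hlt n⟩, ?_⟩
      rw [hC α hα n hn, (hclub α hα n hn).mem_accPoints_iff hα.2]
      exact ⟨hβα, hn'⟩
    · rintro ⟨i, hi, hβ⟩
      obtain ⟨n, rfl⟩ := hnat i hi.2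
      have hn : (F α).1 ≤ n := by exact_mod_cast hi.1
      rw [hC α hα n hn, (hclub α hα n hn).mem_accPoints_iff hα.2] at hβ
      exact ⟨⟨hβ.1.trans hα.1, hβ.2.isSuccLimit⟩, hβ.1⟩
  · obtain ⟨n, rfl⟩ := hnat i hi'
    have hn : (F α).1 ≤ n := by exact_mod_cast hi
    rw [hC α hα n hn] at hβ ⊢
    rw [(hclub α hα n hn).mem_accPoints_iff hα.2] at hβ
    obtain ⟨-, h1, h2⟩ := (hF α hα.1 hα.2).coherent n hn β hβ.1 hβ.2
    exact ⟨by exact_mod_cast h1, by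
      rw [hC β ⟨hβ.1.trans hα.1, hβ.2.isSuccLimit⟩ n h1, h2]⟩
  · -- a limit of limits of `D` has infinitely many limits of `D` below it
    have h1 := clubIn_limPts hreg aleph0_lt_aleph_one ((clubIn_iff hko).1 hD).2.2
    have h2 := clubIn_limPts hreg aleph0_lt_aleph_one ((clubIn_iff hko).1 h1).2.2
    obtain ⟨α, ⟨hα, hl⟩, -⟩ := ((clubIn_iff hko).1 h2).2.2.2 0 hreg.ord_pos
    have hl' : IsLimPt D α := (hl.mono fun δ hδ => hδ.2).of_limPt
    have hαΓ : α ∈ Γ := ⟨hα, hl.isSuccLimit⟩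
    refine ⟨α, ⟨(hD.mem_accPoints_iff hko).2 ⟨hα, hl'⟩, hαΓ⟩, fun i hi hi' he => ?_⟩
    obtain ⟨n, rfl⟩ := hnat i hi'
    have hn : (F α).1 ≤ n := by exact_mod_cast hi
    rw [hC α hαΓ n hn] at he
    have hfin := (hF α hαΓ.1 hαΓ.2).finite n hn
    rw [← he] at hfin
    obtain ⟨δ₀, h3, -, h4⟩ := hl.2 0 hl.1
    obtain ⟨δ, hδ, hmax⟩ := hfin.exists_maximal ⟨δ₀, h4, h3.2.inter_Iio h4.le⟩
    obtain ⟨δ', h5, h6, h7⟩ := hl.2 δ hδ.1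
    exact (hmax ⟨h7, h5.2.inter_Iio h7.le⟩ h6.le).not_gt h6

/-! ### Large families avoiding small colors -/

section

variable {κ θ : Cardinal.{u}} {c : Ordinal.{u} → Ordinal.{u} → Ordinal.{u}}

/-- A disjoint family of size `κ` has a member above any given `ξ < κ`, since distinct members that meet
`ξ + 1` do so in distinct points. -/
theorem exists_mem_above (hκ : κ.IsRegular) {𝒜 : Set (Set Ordinal.{u})}
    (hd : 𝒜.PairwiseDisjoint id) (hc : #𝒜 = Cardinal.lift.{u + 1} κ) {ξ : Ordinal.{u}}
    (hξ : ξ < κ.ord) : ∃ a ∈ 𝒜, ∀ β ∈ a, ξ < β := by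
  by_contra! hcon
  choose! f hf hf' using hcon
  have hinj : Function.Injective (fun a : 𝒜 => (⟨f a, Order.lt_add_one_iff.2 (hf' a a.2)⟩ :
      Iio (ξ + 1))) := by
    intro a b hab
    have hab' : f a = f b := congrArg Subtype.val hab
    by_contra hne
    exact disjoint_left.1 (hd a.2 b.2 fun e => hne (Subtype.ext e)) (hf a a.2)
      (show f a ∈ (b : Set Ordinal) from hab' ▸ hf b b.2)
  have := mk_le_of_injective hinj
  rw [hc, Cardinal.mk_Iio_ordinal, Cardinal.lift_le, ← ord_le] at this
  exact this.not_gt ((isSuccLimit_ord_of_isRegular hκ).add_one_lt hξ)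

/-- If every member of `𝒜` above `δ` contains some `β` with `c δ β ≤ i`, for all `δ` of cofinality
`ν` in a club, then there is an unbounded set all of whose pairs have color at most `i`. The order
`α < β ∧ c α β ≤ i` is a tree order and each member of `𝒜` covers its set of predecessors by few
branches; pressing down selects a coherent sequence of branches. -/
theorem exists_unbounded_homogeneous (hκ : κ.IsRegular) (hκ' : ℵ₀ < κ) (hsub : IsSubadditive κ c)
    {ν σ : Cardinal.{u}} (hν : ν.IsRegular) (hνκ : ν < κ) (hσν : σ < ν)
    {𝒜 : Set (Set Ordinal.{u})}
    (h𝒜 : ∀ a ∈ 𝒜, a ⊆ Iio κ.ord ∧ #a = Cardinal.lift.{u + 1} σ)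
    (hab : ∀ ξ < κ.ord, ∃ a ∈ 𝒜, ∀ β ∈ a, ξ < β) {i : Ordinal.{u}}
    {X : Set Ordinal.{u}} (hX : X ⊆ Iio κ.ord) (hXlim : IsLimPt X κ.ord)
    (hcov : ∀ δ ∈ X, ∀ a ∈ 𝒜, (∀ β ∈ a, δ < β) → ∃ β ∈ a, c δ β ≤ i) :
    ∃ H ⊆ Iio κ.ord, IsLimPt H κ.ord ∧ ∀ α ∈ H, ∀ β ∈ H, α < β → c α β ≤ i := by
  have hko := isSuccLimit_ord_of_isRegular hκ
  choose! a ha haδ using hab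
  have hsmall : ∀ δ < κ.ord, ∀ ε : Ordinal.{u}, ε.cof = ν →
      #(a δ) < Cardinal.lift.{u + 1} ε.cof := by
    intro δ hδ ε hε
    rw [(h𝒜 _ (ha δ hδ)).2, hε]
    exact Cardinal.lift_lt.2 hσν
  set T : Set Ordinal.{u} := {δ ∈ {δ | δ < κ.ord ∧ IsLimPt X δ} | δ.cof = ν} with hT
  have hTs : StationaryIn κ.ord T := stationaryIn_cof hκ hκ' (clubIn_limPts hκ hκ' hXlim) hν hνκ
  -- a cofinal branch below `δ`, together with a point above which it is determined by its members
  have hbr : ∀ δ ∈ T, ∃ ξ < δ, ∃ β ∈ a δ, (∀ ε < δ, ∃ ζ ∈ X, ε < ζ ∧ ζ < δ ∧ c ζ β ≤ i) ∧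
      c ξ β ≤ i ∧ ∀ β' ∈ a δ, c ξ β' ≤ i → ∀ ζ, ξ ≤ ζ → ζ < δ → c ζ β' ≤ i → c ζ β ≤ i := by
    rintro δ ⟨⟨hδ, hXδ⟩, hcof⟩
    have hδlim := hXδ.isSuccLimit
    have h1 : ∃ β ∈ a δ, ∀ ε < δ, ∃ ζ ∈ X, ε < ζ ∧ ζ < δ ∧ c ζ β ≤ i := by
      by_contra! hcon
      choose! b hb hb' using hcon
      obtain ⟨B, hB, hB'⟩ := exists_lt_forall_le (hsmall δ hδ δ hcof) (fun β => b β)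
        (fun β => hb β β.2)
      obtain ⟨ζ, h1, h2, h3⟩ := hXδ.2 B hB
      obtain ⟨β, h4, h5⟩ := hcov ζ h1 (a δ) (ha δ hδ) fun β hβ => h3.trans (haδ δ hδ β hβ)
      exact (hb' β h4 ζ h1 ((hB' ⟨β, h4⟩).trans_lt h2) h3).not_ge h5
    obtain ⟨β, hβ, hβ'⟩ := h1
    have hβκ : β < κ.ord := (h𝒜 _ (ha δ hδ)).1 hβ
    -- every other branch either agrees with the one of `β` or leaves it below `δ`
    have h2 : ∀ β' : a δ, ∃ η < δ, ∀ ξ, η < ξ → ξ < δ → c ξ β ≤ i → c ξ β' ≤ i →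
        ∀ ζ < δ, c ζ β' ≤ i → c ζ β ≤ i := by
      intro β'
      have hβ'κ : (β' : Ordinal) < κ.ord := (h𝒜 _ (ha δ hδ)).1 β'.2
      -- branches meeting cofinally below `δ` coincide below `δ`, by subadditivity
      by_cases hco : ∀ η < δ, ∃ ζ, η < ζ ∧ ζ < δ ∧ c ζ β ≤ i ∧ c ζ β' ≤ i
      · refine ⟨0, hδlim.bot_lt, fun _ _ _ _ _ ζ hζ hc => ?_⟩
        obtain ⟨ζ', h3, h4, h5, h6⟩ := hco ζ hζ
        have h7 := (hsub ζ ζ' β' h3 (h4.trans (haδ δ hδ _ β'.2)) hβ'κ).2.trans (max_le hc h6)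
        exact (hsub ζ ζ' β h3 (h4.trans (haδ δ hδ _ hβ)) hβκ).1.trans (max_le h7 h5)
      · push Not at hco
        obtain ⟨η, hη, hη'⟩ := hco
        exact ⟨η, hη, fun ξ h3 h4 h5 h6 => absurd h6 (hη' ξ h3 h4 h5).not_ge⟩
    choose η hη hη' using h2
    obtain ⟨B, hB, hB'⟩ := exists_lt_forall_le (hsmall δ hδ δ hcof) η hη
    obtain ⟨ξ, -, h4, h5, h6⟩ := hβ' B hB
    exact ⟨ξ, h5, β, hβ, hβ', h6, fun β' hβ₁ h7 ζ _ hζ h8 =>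
      hη' ⟨β', hβ₁⟩ ξ ((hB' _).trans_lt h4) h5 h6 h7 ζ hζ h8⟩
  choose! f hf b hb hbX hbξ hbu using hbr
  obtain ⟨ξ, hξ, hlim⟩ := StationaryIn.exists_isLimPt_fiber hκ hκ' hTs f hf
  have hbδ : ∀ δ ∈ T, δ < b δ ∧ b δ < κ.ord := fun δ hδ =>
    ⟨haδ δ hδ.1.1 _ (hb δ hδ), (h𝒜 _ (ha δ hδ.1.1)).1 (hb δ hδ)⟩
  -- branches chosen at larger ordinals extend those chosen at smaller ones
  have hext : ∀ δ ∈ {δ ∈ T | f δ = ξ}, ∀ δ' ∈ {δ ∈ T | f δ = ξ}, δ ≤ δ' →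
      ∀ ζ ∈ X, ξ < ζ → ζ < δ → c ζ (b δ) ≤ i → c ζ (b δ') ≤ i := by
    rintro δ ⟨hδ, hδξ⟩ δ' ⟨hδ', hδ'ξ⟩ hle ζ hζ hξζ hζδ hcζ
    obtain ⟨β', h1, h2⟩ := hcov ζ hζ (a δ') (ha δ' hδ'.1.1) fun β hβ =>
      (hζδ.trans_le hle).trans (haδ δ' hδ'.1.1 β hβ)
    have h3 : c ξ (b δ) ≤ i := hδξ ▸ hbξ δ hδ
    have h4 : c ξ ζ ≤ i := (hsub ξ ζ (b δ) hξζ (hζδ.trans (hbδ δ hδ).1) (hbδ δ hδ).2).2.trans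
      (max_le h3 hcζ)
    have h5 : c ξ β' ≤ i :=
      (hsub ξ ζ β' hξζ ((hζδ.trans_le hle).trans (haδ δ' hδ'.1.1 β' h1))
        ((h𝒜 _ (ha δ' hδ'.1.1)).1 h1)).1.trans (max_le h4 h2)
    exact hbu δ' hδ' β' h1 (hδ'ξ ▸ h5) ζ (hδ'ξ ▸ hξζ.le) (hζδ.trans_le hle) h2
  refine ⟨{ζ | ζ ∈ X ∧ ξ < ζ ∧ ∃ δ ∈ {δ ∈ T | f δ = ξ}, ζ < δ ∧ c ζ (b δ) ≤ i},
    fun ζ hζ => hX hζ.1, ⟨hκ.ord_pos, fun ε hε => ?_⟩, ?_⟩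
  · obtain ⟨δ, h1, h2, h3⟩ := hlim.2 (max ε ξ) (max_lt hε hξ)
    obtain ⟨ζ, h4, h5, h6, h7⟩ := hbX δ h1.1 (max ε ξ) h2
    exact ⟨ζ, ⟨h4, (le_max_right _ _).trans_lt h5, δ, h1, h6, h7⟩,
      (le_max_left _ _).trans_lt h5, hX h4⟩
  · rintro ζ ⟨hζ, hξζ, δ, hδ, hζδ, hcζ⟩ ζ' ⟨hζ', hξζ', δ', hδ', hζδ', hcζ'⟩ hlt
    obtain ⟨δm, hm, h1, h2⟩ : ∃ δm ∈ {δ ∈ T | f δ = ξ}, δ ≤ δm ∧ δ' ≤ δm := by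
      rcases le_total δ δ' with h | h
      · exact ⟨δ', hδ', h, le_rfl⟩
      · exact ⟨δ, hδ, le_rfl, h⟩
    have h3 := hext δ hδ δm hm h1 ζ hζ hξζ hζδ hcζ
    have h4 := hext δ' hδ' δm hm h2 ζ' hζ' hξζ' hζδ' hcζ'
    exact (hsub ζ ζ' (b δm) hlt ((hζδ'.trans_le h2).trans (hbδ δm hm.1).1)
      (hbδ δm hm.1).2).2.trans (max_le h3 h4)

/-- Pressing down on a bound for all the level sets `{ξ < δ | c ξ β ≤ i}`, for `β` in the chosen set
above `δ`. -/
theorem exists_subfamily_of_stationary (hκ : κ.IsRegular) (hκ' : ℵ₀ < κ)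
    (hcl : IsStronglyClosed κ θ c) {σ ν : Cardinal.{u}}
    (hσν : σ < ν) (hσκ : σ < κ) (hσ : σ ≠ 0) {𝒜 : Set (Set Ordinal.{u})}
    (h𝒜 : ∀ a ∈ 𝒜, a ⊆ Iio κ.ord ∧ #a = Cardinal.lift.{u + 1} σ)
    {i : Ordinal.{u}} (hi : i < θ.ord)
    {T : Set Ordinal.{u}} (hT : StationaryIn κ.ord T) (hTcof : ∀ δ ∈ T, 0 < δ ∧ δ.cof = ν)
    (hTa : ∀ δ ∈ T, ∃ a ∈ 𝒜, ∀ β ∈ a, δ < β ∧ i < c δ β) :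
    ∃ ℬ ⊆ 𝒜, #ℬ = Cardinal.lift.{u + 1} κ ∧
      ∀ a ∈ ℬ, ∀ b ∈ ℬ, a ≠ b → (∀ α ∈ a, ∀ β ∈ b, α < β) → ∀ α ∈ a, ∀ β ∈ b, i < c α β := by
  choose! a ha haδ using hTa
  have hne : ∀ δ ∈ T, (a δ).Nonempty := by
    intro δ hδ
    rw [nonempty_iff_ne_empty]
    intro he
    have := (h𝒜 _ (ha δ hδ)).2
    rw [he, mk_eq_zero, eq_comm, Cardinal.lift_eq_zero] at this
    exact hσ this
  have hg : ∀ δ, ∃ g < κ.ord, δ ∈ T → ∀ β ∈ a δ, β ≤ g := by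
    intro δ
    by_cases hδ : δ ∈ T
    · obtain ⟨g, hg, hg'⟩ := exists_lt_forall_le (o := κ.ord) (ι := a δ)
        (by rw [(h𝒜 _ (ha δ hδ)).2, hκ.cof_ord]; exact Cardinal.lift_lt.2 hσκ)
        (fun β => β) (fun β => (h𝒜 _ (ha δ hδ)).1 β.2)
      exact ⟨g, hg, fun _ β hβ => hg' ⟨β, hβ⟩⟩
    · exact ⟨0, hκ.ord_pos, fun h => absurd h hδ⟩
  choose g hgκ hg using hg
  -- on the closure points of `g`, each chosen set lies below the next point
  set T' := T ∩ {δ | δ < κ.ord ∧ 0 < δ ∧ ∀ ξ < δ, g ξ < δ} with hT'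
  have hT's : StationaryIn κ.ord T' := StationaryIn.inter_clubIn hκ hκ' hT
    (clubIn_closurePoints hκ hκ' g fun ξ _ => hgκ ξ)
  have hbd : ∀ δ ∈ T', ∃ ε < δ, ∀ β ∈ a δ, ∀ ξ < δ, c ξ β ≤ i → ξ ≤ ε := by
    rintro δ ⟨hδ, -⟩
    have h1 : ∀ β : a δ, ∃ ε < δ, ∀ ξ < δ, c ξ β ≤ i → ξ ≤ ε := by
      intro β
      have hδβ := haδ δ hδ β β.2
      have h2 : ¬ IsLimPt (levelSet c i β) δ := fun hl =>
        (hcl β ((h𝒜 _ (ha δ hδ)).1 β.2) i hi δ hδβ.1 hl).not_gt hδβ.2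
      simp only [IsLimPt, (hTcof δ hδ).1, true_and, not_forall] at h2
      obtain ⟨ε, hε, h3⟩ := h2
      refine ⟨ε, hε, fun ξ hξ hc => ?_⟩
      by_contra! hlt
      exact h3 ⟨ξ, ⟨hξ.trans hδβ.1, hc⟩, hlt, hξ⟩
    choose ε hε hε' using h1
    obtain ⟨B, hB, hB'⟩ := exists_lt_forall_le (o := δ) (ι := a δ)
      (by rw [(h𝒜 _ (ha δ hδ)).2, (hTcof δ hδ).2]; exact Cardinal.lift_lt.2 hσν) ε hε
    exact ⟨B, hB, fun β hβ ξ hξ hc => (hε' ⟨β, hβ⟩ ξ hξ hc).trans (hB' _)⟩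
  choose! f hf hf' using hbd
  obtain ⟨ε, hε, hlim⟩ := StationaryIn.exists_isLimPt_fiber hκ hκ' hT's f hf
  set U := {δ ∈ T' | f δ = ε} with hU
  have hord : ∀ δ ∈ U, ∀ δ' ∈ U, δ < δ' → ∀ α ∈ a δ, α < δ' := fun δ hδ δ' hδ' hlt α hα =>
    (hg δ hδ.1.1 α hα).trans_lt (hδ'.1.2.2.2 δ hlt)
  have hinj : InjOn a U := by
    intro δ hδ δ' hδ' he
    by_contra hne'
    rcases Ne.lt_or_gt hne' with hlt | hlt
    · obtain ⟨α, hα⟩ := hne δ hδ.1.1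
      exact (hord δ hδ δ' hδ' hlt α hα).not_gt (haδ δ' hδ'.1.1 α (he ▸ hα)).1
    · obtain ⟨α, hα⟩ := hne δ' hδ'.1.1
      exact (hord δ' hδ' δ hδ hlt α hα).not_gt (haδ δ hδ.1.1 α (he ▸ hα)).1
  refine ⟨a '' U, ?_, ?_, ?_⟩
  · rintro _ ⟨δ, hδ, rfl⟩
    exact ha δ hδ.1.1
  · rw [mk_image_eq_of_injOn _ _ hinj]
    exact (mk_eq_iff_isLimPt hκ fun δ hδ => hT.1 hδ.1.1).2 hlim
  · rintro _ ⟨δ, hδ, rfl⟩ _ ⟨δ', hδ', rfl⟩ hne' hlt α hα β hβ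
    have hδδ' : δ < δ' := by
      by_contra! hle
      have : δ' < δ := lt_of_le_of_ne hle fun e => hne' (by rw [e])
      obtain ⟨β', hβ'⟩ := hne δ' hδ'.1.1
      exact ((hord δ' hδ' δ hδ this β' hβ').trans (haδ δ hδ.1.1 α hα).1).not_gt
        (hlt α hα β' hβ')
    by_contra! hle
    have h1 := hf' δ' hδ'.1 β hβ α (hord δ hδ δ' hδ' hδδ' α hα) hle
    rw [hδ'.2] at h1
    have h2 : ε < δ := hδ.2 ▸ hf δ hδ.1
    exact (h1.trans_lt h2).not_gt (haδ δ hδ.1.1 α hα).1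

theorem exists_isRegular_of_lt_supReg (hθ : θ.IsRegular) (hθκ : θ < κ) {σ : Cardinal.{u}}
    (hσ : σ < supReg κ) : ∃ ν : Cardinal.{u}, ν.IsRegular ∧ ν < κ ∧ σ < ν := by
  obtain ⟨ν, ⟨h1, h2⟩, h3⟩ := exists_lt_of_lt_csSup
    (s := {ν : Cardinal.{u} | ν.IsRegular ∧ ν < κ}) ⟨θ, hθ, hθκ⟩ hσ
  exact ⟨ν, h1, h2, h3⟩

theorem le_supReg (hθ : θ.IsRegular) (hθκ : θ < κ) : θ ≤ supReg κ := by
  rw [supReg]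
  exact le_csSup ⟨κ, fun _ h => h.2.le⟩ ⟨hθ, hθκ⟩

theorem NoUnboundedHomogeneous.witnessesU (hκ : κ.IsRegular) (hθ : θ.IsRegular) (hθκ : θ < κ)
    (hcl : IsStronglyClosed κ θ c) (hsub : IsSubadditive κ c)
    (hno : NoUnboundedHomogeneous κ θ c) : WitnessesU κ κ θ (supReg κ) c := by
  intro σ hσ 𝒜 h𝒜 hd hcard i hi
  have hκ' : ℵ₀ < κ := hθ.aleph0_le.trans_lt hθκ
  have hko := isSuccLimit_ord_of_isRegular hκ
  obtain ⟨ν, hν, hνκ, hσν⟩ := exists_isRegular_of_lt_supReg hθ hθκ hσ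
  have hab : ∀ ξ < κ.ord, ∃ a ∈ 𝒜, ∀ β ∈ a, ξ < β := fun ξ hξ => exists_mem_above hκ hd hcard hξ
  have hσ0 : σ ≠ 0 := by
    rintro rfl
    have h1 : 𝒜 ⊆ {∅} := by
      intro a ha
      have := (h𝒜 a ha).2
      rw [Cardinal.lift_zero, mk_set_eq_zero_iff] at this
      exact this
    have h2 := mk_le_mk_of_subset h1
    rw [hcard, mk_singleton, ← Cardinal.lift_one.{u, u + 1}, Cardinal.lift_le] at h2
    exact (h2.trans_lt one_lt_aleph0).not_gt hκ'
  set T : Set Ordinal.{u} :=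
    {δ | δ < κ.ord ∧ δ.cof = ν ∧ ∃ a ∈ 𝒜, ∀ β ∈ a, δ < β ∧ i < c δ β} with hT
  by_cases hTs : StationaryIn κ.ord T
  · refine exists_subfamily_of_stationary hκ hκ' hcl hσν (hσν.trans hνκ) hσ0 h𝒜 hi hTs
      (fun δ hδ => ⟨?_, hδ.2.1⟩) fun δ hδ => hδ.2.2
    rw [← cof_pos, hδ.2.1]
    exact hν.pos
  · exfalso
    rw [stationaryIn_iff, not_and] at hTs
    have := hTs fun δ hδ => hδ.1
    push Not at this
    obtain ⟨D, hD, hD'⟩ := this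
    obtain ⟨H, h1, h2, h3⟩ := exists_unbounded_homogeneous hκ hκ' hsub hν hνκ hσν h𝒜 hab (i := i)
      (X := {δ ∈ D | δ.cof = ν}) (fun δ hδ => hD.1 hδ.1)
      (StationaryIn.isLimPt hκ hκ' (stationaryIn_cof hκ hκ' hD hν hνκ))
      (by
        rintro δ ⟨hδ, hcof⟩ a ha hlt
        by_contra! hcon
        exact hD' δ ⟨hD.1 hδ, hcof, a, ha, fun β hβ => ⟨hlt β hβ, hcon β hβ⟩⟩ hδ)
    obtain ⟨α, hα, β, hβ, hlt, hc⟩ := hno H h1 h2 i hi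
    exact (h3 α hα β hβ hlt).not_gt hc

theorem WitnessesU.mono {μ μ' χ χ' : Cardinal.{u}} (hμ : μ' ≤ μ) (hχ : χ' ≤ χ)
    (h : WitnessesU κ μ θ χ c) : WitnessesU κ μ' θ χ' c := by
  intro σ hσ 𝒜 h𝒜 hd hcard i hi
  obtain ⟨ℬ, h1, h2, h3⟩ := h σ (hσ.trans_le hχ) 𝒜 h𝒜 hd hcard i hi
  obtain ⟨ℬ', h4, h5⟩ := le_mk_iff_exists_subset.1
    (show Cardinal.lift.{u + 1} μ' ≤ #ℬ by rw [h2]; exact Cardinal.lift_le.2 hμ)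
  exact ⟨ℬ', h4.trans h1, h5, fun a ha b hb => h3 a (h4 ha) b (h4 hb)⟩

end

/-! ### Large starting indices on a stationary set -/

namespace IsWeakIndexedSquareSeq

variable {κ θ : Cardinal.{u}} {Γ : Set Ordinal.{u}} {start : Ordinal.{u} → Ordinal.{u}}
  {C : Ordinal.{u} → Ordinal.{u} → Set Ordinal.{u}} (h : IsWeakIndexedSquareSeq κ θ Γ start C)
include h

open Classical in
/-- Raising the starting index at each `α > η` to the least index that captures `η` leaves a square
sequence: by coherence, an accumulation point of `C α i` above `η` captures `η` at the index `i` if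
`α` does. -/
theorem raise_start {η : Ordinal.{u}} (hη : η ∈ Γ) :
    IsWeakIndexedSquareSeq κ θ Γ
      (fun α => if η < α then accIndex θ start C η α else start α) C := by
  set s : Ordinal.{u} → Ordinal.{u} :=
    fun α => if η < α then accIndex θ start C η α else start α with hs
  have hle : ∀ α ∈ Γ, start α ≤ s α := by
    intro α hα
    simp only [hs]
    split_ifs with hlt
    · exact (h.accIndex_spec hη hα hlt).1
    · exact le_rfl
  have hsθ : ∀ α ∈ Γ, s α < θ.ord := by
    intro α hα
    simp only [hs]
    split_ifs with hlt
    · exact (h.accIndex_spec hη hα hlt).2.1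
    · exact h.start_lt α hα
  refine ⟨h.mem_of_cof_ne, h.subset_acc, hsθ,
    fun α hα i hi => h.club α hα i ((hle α hα).trans hi),
    fun α hα i j hi => h.mono α hα i j ((hle α hα).trans hi), fun α hα => ?_,
    fun α hα i hi hi' β hβ => ?_, fun D hD => ?_⟩
  · ext β
    simp only [mem_iUnion]
    constructor
    · rintro ⟨hβ, hβα⟩
      obtain ⟨i, h1, h2, h3⟩ := h.exists_mem_accPoints hα hβ hβα
      exact ⟨max i (s α), ⟨le_max_right _ _, max_lt h2 (hsθ α hα)⟩,
        h.accPoints_mono hα h1 (le_max_left _ _) (max_lt h2 (hsθ α hα)) h3⟩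
    · rintro ⟨i, hi, hβ⟩
      have hi1 := (hle α hα).trans hi.1
      exact ⟨h.mem_of_mem_accPoints hα hi1 hi.2 hβ,
        ((h.mem_accPoints_iff hα hi1 hi.2).1 hβ).1⟩
  · have hi1 := (hle α hα).trans hi
    obtain ⟨h1, h2⟩ := h.coherent α hα i hi1 hi' β hβ
    refine ⟨?_, h2⟩
    simp only [hs]
    split_ifs with hlt
    · have hβΓ := h.mem_of_mem_accPoints hα hi1 hi' hβ
      have hβα := ((h.mem_accPoints_iff hα hi1 hi').1 hβ).1
      rw [h.accIndex_le_iff hη hβΓ hlt hi']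
      refine ⟨h1, (h.accPoints_eq hα hi1 hi' hβ hlt).2 ?_⟩
      simp only [hs, hlt.trans hβα, if_true] at hi
      exact ((h.accIndex_le_iff hη hα (hlt.trans hβα) hi').1 hi).2
    · exact h1
  · obtain ⟨α, hα, hne⟩ := h.nontrivial D hD
    exact ⟨α, hα, fun i hi => hne i ((hle α hα.2).trans hi)⟩

/-- Otherwise each `η ∈ Γ` is captured at a fixed index on a club relative to `T`; one index works for
unboundedly many `η`, and the diagonal intersection of their clubs makes these cohere. -/
theorem exists_forall_stationaryIn (hκ : κ.IsRegular) (hκ' : ℵ₀ < κ) (hθκ : θ < κ)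
    {T : Set Ordinal.{u}} (hT : StationaryIn κ.ord T) (hTΓ : T ⊆ Γ) :
    ∃ η ∈ Γ, ∀ i < θ.ord,
      StationaryIn κ.ord {α | α ∈ T ∧ η < α ∧ i < accIndex θ start C η α} := by
  by_contra! hcon
  have hTlim := StationaryIn.isLimPt hκ hκ' hT
  have hclub : ∀ η ∈ Γ, ∃ i < θ.ord, ∃ D, ClubIn κ.ord D ∧
      ∀ α ∈ T, α ∈ D → η < α → accIndex θ start C η α ≤ i := by
    intro η hη
    obtain ⟨i, hi, hns⟩ := hcon η hη
    rw [stationaryIn_iff, not_and] at hns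
    have := hns fun α hα => h.lt_ord (hTΓ hα.1)
    push Not at this
    obtain ⟨D, hD, hD'⟩ := this
    refine ⟨i, hi, D, hD, fun α h1 h2 h3 => ?_⟩
    by_contra! h4
    exact hD' α ⟨h1, h3, h4⟩ h2
  choose! f hf D hD hD' using hclub
  obtain ⟨i, hi, hi'⟩ := exists_isLimPt_fiber hκ hθκ (h.isLimPt_ord hκ hκ') f
    fun α hα _ => hf α hα
  -- diagonally intersect the clubs of the `η` with index `i`
  obtain ⟨E, hE, hE'⟩ := exists_clubIn_diagonal hκ hκ'
    (D := fun η => {ξ | ξ < κ.ord ∧ (η ∈ Γ → ξ ∈ D η)}) (by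
      intro η hη
      by_cases hηΓ : η ∈ Γ
      · convert! hD η hηΓ using 1
        ext ξ
        simp only [mem_ofPred_eq, hηΓ, true_imp_iff]
        exact ⟨fun h => h.2, fun h => ⟨(hD η hηΓ).1 h, h⟩⟩
      · simp only [hηΓ, false_imp_iff, and_true]
        have := isSuccLimit_ord_of_isRegular hκ
        exact (clubIn_iff this).2
          ⟨fun _ h => h, fun δ h _ => h, isLimPt_Iio this le_rfl⟩)
  have hTE := StationaryIn.isLimPt hκ hκ' (StationaryIn.inter_clubIn hκ hκ' hT hE)
  refine h.not_isLimPt_of_forall_mem_accPoints hκ (fun η hη => hη.1) hi ?_ hi'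
  intro β hβ α hα hαβ
  obtain ⟨γ, ⟨hγT, hγE⟩, hβγ, -⟩ := hTE.2 β (h.lt_ord hβ.1)
  have key : ∀ η ∈ {η ∈ Γ | f η = i}, η < γ →
      start γ ≤ i ∧ η ∈ accPoints (C γ i) := by
    intro η hη hηγ
    have := hD' η hη.1 γ hγT ((hE' γ hγE η hηγ).2 hη.1) hηγ
    rw [hη.2] at this
    exact (h.accIndex_le_iff hη.1 (hTΓ hγT) hηγ hi).1 this
  obtain ⟨h1, h2⟩ := key β hβ hβγ
  obtain ⟨-, h3⟩ := key α hα (hαβ.trans hβγ)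
  exact ⟨(h.coherent γ (hTΓ hγT) i h1 hi β h2).1,
    (h.accPoints_eq (hTΓ hγT) h1 hi h2 hαβ).2 h3⟩

open Classical in
/-- The clubs, and so `Γ`, are those of the given sequence; only the starting indices change. -/
theorem exists_start_unbounded_on_stationary (hκ : κ.IsRegular) (hκ' : ℵ₀ < κ) (hθκ : θ < κ)
    (S : Set Ordinal.{u}) :
    ∃ start', IsWeakIndexedSquareSeq κ θ Γ start' C ∧
      (¬ StationaryIn κ.ord (S ∩ Γ) ∨
        ∀ i < θ.ord, StationaryIn κ.ord {α | α ∈ S ∩ Γ ∧ i < start' α}) := by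
  by_cases hS : StationaryIn κ.ord (S ∩ Γ)
  · obtain ⟨η, hη, hst⟩ := h.exists_forall_stationaryIn hκ hκ' hθκ hS inter_subset_right
    refine ⟨_, h.raise_start hη, Or.inr fun i hi => ?_⟩
    obtain ⟨h1, h2⟩ := stationaryIn_iff.1 (hst i hi)
    refine stationaryIn_iff.2 ⟨fun α hα => h.lt_ord hα.1.2, fun E hE => ?_⟩
    obtain ⟨δ, ⟨h3, h4, h5⟩, h6⟩ := h2 E hE
    refine ⟨δ, ⟨h3, ?_⟩, h6⟩
    simpa [h4] using h5
  · exact ⟨start, h, Or.inl hS⟩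

end IsWeakIndexedSquareSeq

/-! ### The equivalence -/

theorem exists_isRegular_ne {κ θ : Cardinal.{u}} (hθκ : θ < κ) (hθ : θ.IsRegular)
    (hne : ¬ (κ = ℵ₁ ∧ θ = ℵ₀)) : ∃ ν : Cardinal.{u}, ν.IsRegular ∧ ν < κ ∧ ν ≠ θ := by
  by_cases h : θ = ℵ₀
  · subst h
    refine ⟨ℵ₁, isRegular_aleph_one, lt_of_le_of_ne ?_ fun e => hne ⟨e.symm, rfl⟩,
      aleph0_lt_aleph_one.ne'⟩
    rw [← succ_aleph0]
    exact Order.succ_le_of_lt hθκ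
  · exact ⟨ℵ₀, isRegular_aleph0, hθ.aleph0_le.trans_lt hθκ, Ne.symm h⟩

theorem weakIndexedSquare_of_hasClosedSubadditiveWitness {κ θ : Cardinal.{u}} (hκ : κ.IsRegular)
    (hθ : θ.IsRegular) (hθκ : θ < κ) (h : HasClosedSubadditiveWitness κ 2 θ 2) :
    WeakIndexedSquare κ θ := by
  by_cases hne : κ = ℵ₁ ∧ θ = ℵ₀
  · obtain ⟨rfl, rfl⟩ := hne
    exact weakIndexedSquare_aleph_one
  · obtain ⟨ν, hν, hνκ, hνθ⟩ := exists_isRegular_ne hθκ hθ hne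
    obtain ⟨c, hcol, hcl, hsub, hU⟩ := h
    exact ⟨_, _, _, isWeakIndexedSquareSeq_levelSet hκ hθ hθκ hν hνκ hνθ hcol hcl hsub
      (hU.noUnboundedHomogeneous hκ)⟩

theorem theoremA (κ θ : Cardinal.{u}) (hκ : κ.IsRegular) (hθ : θ.IsRegular) (hθκ : θ < κ) :
    List.TFAE [
      WeakIndexedSquare κ θ,
      HasClosedSubadditiveWitness κ 2 θ 2,
      HasClosedSubadditiveWitness κ κ θ (supReg κ),
      ∀ S : Set Ordinal.{u}, StationaryIn κ.ord S →
        ∃ (Γ : Set Ordinal.{u}) (start : Ordinal.{u} → Ordinal.{u})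
          (C : Ordinal.{u} → Ordinal.{u} → Set Ordinal.{u}),
          IsWeakIndexedSquareSeq κ θ Γ start C ∧
          (¬ StationaryIn κ.ord (S ∩ Γ) ∨
            ∀ i < θ.ord, StationaryIn κ.ord {α | α ∈ S ∩ Γ ∧ i < start α})] := by
  have hκ' : ℵ₀ < κ := hθ.aleph0_le.trans_lt hθκ
  have h2 : ∀ {μ : Cardinal.{u}}, ℵ₀ ≤ μ → (2 : Cardinal.{u}) ≤ μ := fun h =>
    (ofNat_lt_aleph0 (n := 2)).le.trans h
  tfae_have 1 → 3 := by
    rintro ⟨Γ, start, C, h⟩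
    have hcol := h.isColoring_squareColoring hκ hθ hκ'
    have hcl := h.isStronglyClosed_squareColoring hκ hκ'
    have hsub := h.isSubadditive_squareColoring hκ hκ'
    exact ⟨_, hcol, hcl.isClosedColoring hcol, hsub,
      (h.noUnboundedHomogeneous_squareColoring hκ hκ').witnessesU hκ hθ hθκ hcl hsub⟩
  tfae_have 3 → 2 := by
    rintro ⟨c, hcol, hcl, hsub, hU⟩
    exact ⟨c, hcol, hcl, hsub,
      hU.mono (h2 hκ.aleph0_le) (h2 (hθ.aleph0_le.trans (le_supReg hθ hθκ)))⟩
  tfae_have 2 → 1 := weakIndexedSquare_of_hasClosedSubadditiveWitness hκ hθ hθκ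
  tfae_have 1 → 4 := by
    rintro ⟨Γ, start, C, h⟩ S -
    obtain ⟨start', h'⟩ := h.exists_start_unbounded_on_stationary hκ hκ' hθκ S
    exact ⟨Γ, start', C, h'⟩
  tfae_have 4 → 1 := by
    intro h
    have hko := isSuccLimit_ord_of_isRegular hκ
    obtain ⟨Γ, start, C, h', -⟩ := h (Iio κ.ord) (stationaryIn_iff.2 ⟨Subset.rfl, fun D hD => by
      obtain ⟨δ, h1, -, h3⟩ := ((clubIn_iff hko).1 hD).2.2.2 0 hκ.ord_pos
      exact ⟨δ, h3, h1⟩⟩)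
    exact ⟨Γ, start, C, h'⟩
  tfae_finish
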